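/- A group $M$ is \emph{existentially closed} if every quantifier-free formula $\varphi(\bar x,\bar m)$ in the language $\{1,\cdot,{}^{-1}\}$ of groups, with parameters $\bar m$ from $M$, that is solved in some group $N\ge M$ is already solved in $M$. For a finite tuple $\bar g$ generating a group $G$, the word problem $W(G)=W(G,\bar g)$ is the set of (codes of) words in the letters $\bar g$ and their formal inverses that are equal to $1$ in $G$. For $X\subseteq\mathbb N$, $X'$ is the Turing jump of $X$, and $X$ \emph{computes} a countable group $M$ if for some enumeration $(m_i)_{i\in\mathbb N}$ of $M$ the quantifier-free diagram of $M$, i.e. the set of (Gödel numbers of) quantifier-free sentences with constants for the $m_i$ that hold in $M$, is Turing reducible to $X$. We write $Y\le_{\mathrm e}X$ for enumeration reducibility: there is a c.e. set $A$ of pairs $(n,D)$, with $n\in\mathbb N$ and $D\subseteq\mathbb N$ finite, such that $n\in Y$ iff $(n,D)\in A$ for some $D\subseteq X$. \textbf{Theorem.} Let $G$ be a finitely generated group, with word problem $W(G)$ with respect to any finite generating tuple. Then: (1) $W(G)'$ computes a countable existentially closed group that contains an isomorphic copy of $G$. (2) There is a countable existentially closed group $M_G$ whose finitely generated subgroups are,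 up to isomorphism, exactly the finitely generated groups $F$ with $W(F)\le_{\mathrm e}W(G)$. (Here $W(F)$ may be taken with respect to any finite generating tuple of $F$.) -/

import Mathlib

/-! ### Oracle computability: characteristic functions, Turing reducibility, the Turing jump -/

open Classical in
/-- The characteristic function of a set of natural numbers, as an oracle. -/
noncomputable def charOracle (X : Set ℕ) : ℕ →. ℕ :=
  fun n => Part.some (if n ∈ X then 1 else 0)

/-- Turing reducibility `Y ≤ X` between sets of natural numbers. -/
def SetTuringReducible (Y X : Set ℕ) : Prop :=
  TuringReducible (charOracle Y) (charOracle X)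

/-- Programs for oracle machines; the constructors are those of `Nat.RecursiveIn`, with one
instruction `oracle` that queries the oracle. -/
inductive OracleCode : Type
  | zero : OracleCode
  | succ : OracleCode
  | left : OracleCode
  | right : OracleCode
  | oracle : OracleCode
  | pair : OracleCode → OracleCode → OracleCode
  | comp : OracleCode → OracleCode → OracleCode
  | prec : OracleCode → OracleCode → OracleCode
  | rfind : OracleCode → OracleCode

namespace OracleCode

/-- The partial function computed by a program with oracle `g`. -/
def eval (g : ℕ →. ℕ) : OracleCode → ℕ →. ℕ
  | zero => fun _ => Part.some 0
  | succ => fun n => Part.some (n + 1)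
  | left => fun n => Part.some (Nat.unpair n).1
  | right => fun n => Part.some (Nat.unpair n).2
  | oracle => g
  | pair cf ch => fun n => Nat.pair <$> eval g cf n <*> eval g ch n
  | comp cf ch => fun n => eval g ch n >>= eval g cf
  | prec cf ch => fun p =>
      let (a, n) := Nat.unpair p
      n.rec (eval g cf a) fun y IH => do
        let i ← IH
        eval g ch (Nat.pair a (Nat.pair y i))
  | rfind cf => fun a => Nat.rfind fun n => (fun m => decide (m = 0)) <$> eval g cf (Nat.pair a n)

/-- The Gödel number of a program. -/
def number : OracleCode → ℕ
  | zero => 0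
  | succ => 1
  | left => 2
  | right => 3
  | oracle => 4
  | pair cf ch => 4 * Nat.pair (number cf) (number ch) + 5
  | comp cf ch => 4 * Nat.pair (number cf) (number ch) + 6
  | prec cf ch => 4 * Nat.pair (number cf) (number ch) + 7
  | rfind cf => 4 * number cf + 8

end OracleCode

/-- The Turing jump `X'`: the numbers `e` such that the `e`-th program with oracle `X` halts on
input `e`. -/
def turingJump (X : Set ℕ) : Set ℕ :=
  {e | ∃ c : OracleCode, c.number = e ∧ (c.eval (charOracle X) e).Dom}

/-! ### Enumeration reducibility -/

/-- `Y` is enumeration reducible to `X`: there is a c.e. set `A` of pairs `(n, D)`, with `D` a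
finite set of natural numbers given by a list, such that `n ∈ Y` if and only if `(n, D) ∈ A` for
some `D ⊆ X`. -/
def EnumReducible (Y X : Set ℕ) : Prop :=
  ∃ A : Set (ℕ × List ℕ), REPred (fun p => p ∈ A) ∧
    ∀ n, n ∈ Y ↔ ∃ D : List ℕ, (n, D) ∈ A ∧ ∀ m ∈ D, m ∈ X

/-! ### The word problem -/

/-- The word problem `W(G, g)` of a group with respect to a finite tuple `g`: the set of (codes of)
words in the letters `g i` and their formal inverses that are equal to `1` in `G`. The letter
`(i, true)` stands for `g i` and the letter `(i, false)` for its inverse. -/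
def wordProblem {G : Type*} [Group G] {n : ℕ} (g : Fin n → G) : Set ℕ :=
  {k | ∃ w : List (Fin n × Bool), Encodable.encode w = k ∧
    (w.map fun x => cond x.2 (g x.1) (g x.1)⁻¹).prod = 1}

/-! ### The language of groups, existentially closed groups, quantifier-free diagrams -/

/-- The function symbols of the language of groups. -/
inductive GroupFunc : ℕ → Type
  | one : GroupFunc 0
  | inv : GroupFunc 1
  | mul : GroupFunc 2

/-- The first-order language of groups. -/
def groupLanguage : FirstOrder.Language :=
  { Functions := GroupFunc
    Relations := fun _ => Empty }

/-- Every group is a structure for the language of groups. -/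
instance groupLanguageStructure (G : Type*) [Group G] : groupLanguage.Structure G where
  funMap := fun {_} f x =>
    match f, x with
    | GroupFunc.one, _ => 1
    | GroupFunc.inv, x => (x 0)⁻¹
    | GroupFunc.mul, x => x 0 * x 1
  RelMap := fun {_} r _ => r.elim

/-- `M` is an existentially closed group: every quantifier-free formula in finitely many variables,
with parameters from `M`, that is solved in some group `N ≥ M` is solved in `M`. -/
def IsExistentiallyClosedGroup.{u} (M : Type u) [Group M] : Prop :=
  ∀ (n : ℕ) (φ : groupLanguage.Formula (M ⊕ Fin n)), φ.IsQF →
    ∀ (N : Type u) [Group N] (j : M →* N), Function.Injective j →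
      (∃ b : Fin n → N, φ.Realize (Sum.elim j b)) →
        ∃ a : Fin n → M, φ.Realize (Sum.elim id a)

/-- Gödel numbers of terms of the language of groups; the letter `Sum.inl i` is the `i`-th constant
for an element of the structure, `Sum.inr j` is the `j`-th bound variable. -/
def groupTermNumber {n : ℕ} : groupLanguage.Term (ℕ ⊕ Fin n) → ℕ
  | .var (.inl i) => Nat.pair 0 i
  | .var (.inr j) => Nat.pair 1 j
  | .func GroupFunc.one _ => Nat.pair 2 0
  | .func GroupFunc.inv ts => Nat.pair 3 (groupTermNumber (ts 0))
  | .func GroupFunc.mul ts => Nat.pair 4 (Nat.pair (groupTermNumber (ts 0)) (groupTermNumber (ts 1)))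

/-- Gödel numbers of formulas of the language of groups with constants indexed by `ℕ`. -/
def groupFormulaNumber : {n : ℕ} → groupLanguage.BoundedFormula ℕ n → ℕ
  | _, .falsum => Nat.pair 0 0
  | _, .equal s t => Nat.pair 1 (Nat.pair (groupTermNumber s) (groupTermNumber t))
  | _, .rel r _ => Empty.elim r
  | _, .imp φ ψ => Nat.pair 2 (Nat.pair (groupFormulaNumber φ) (groupFormulaNumber ψ))
  | _, .all φ => Nat.pair 3 (groupFormulaNumber φ)

/-- The quantifier-free diagram of a group with respect to an enumeration `ν` of its elements: the
set of (Gödel numbers of) quantifier-free sentences that hold in the group, in the language of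
groups with an additional constant for each `i`, interpreted by `ν i`. -/
def qfDiagram {M : Type*} [Group M] (ν : ℕ → M) : Set ℕ :=
  {k | ∃ φ : groupLanguage.Formula ℕ, groupFormulaNumber φ = k ∧ φ.IsQF ∧ φ.Realize ν}

/-- The set `X` computes the group `M` (`M` is `X`-computable): for some enumeration of `M`, the
quantifier-free diagram of `M` is Turing reducible to `X`. -/
def ComputesGroup (X : Set ℕ) (M : Type*) [Group M] : Prop :=
  ∃ ν : ℕ → M, Function.Surjective ν ∧ SetTuringReducible (qfDiagram ν) X

/-! ### Enumeration reducibility for subsets of encodable types -/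

/-! Both groups arise from one construction: the free group on countably many letters modulo the
normal closure of an increasing union of relator sets `E s`, built together with increasing sets `I
s` of words that must stay nontrivial. Every pair is consistent: no word of `I s` follows from `E
s`. A system of equations and inequations is treated at one stage, with fresh letters for its
variables, and is added if this preserves consistency. One treatment suffices: if the system is
solved in a group above the limit, the old letters together with the solution satisfy `E s`, `I s`
and the system there, so adding it was consistent (`isExistentiallyClosedGroup_of_stages`). A
quantifier-free formula reduces to such systems because its truth value depends only on which of
finitely many words are trivial (`exists_sysWords_of_isQF`).

For (1), the start consists of all relators and nonrelators of the group. A consequence is witnessed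
by a finite product of conjugates of relators, so inconsistency of a finite extension is enumerable
from the positive and negative facts about the word problem (`enumRed_inconsistentSystems`), and the
jump decides it (`setTuringReducible_turingJump`). The jump therefore computes the greedy run, and a
word is trivial in the limit iff it is accepted when proposed as an equation. Evaluating sentences
gives the whole diagram (`computesGroup_quotient`).

For (2), each `E s` is enumeration reducible to `X` and uses only letters below a bound, and `I s`
is the set of all words below the bound that do not follow. This freezes the group on these letters,
so the word problem of a finitely generated subgroup is read off from a single `relClosure (E s)`,
which is enumeration reducible to `X` (`EnumRed.relClosure`). Conversely, only countably many sets
are reducible to `X`, and each of them that is the word problem of a group is inserted at some stage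
as a free factor (`exists_extends_group`). The sequence of stages need not be effective here. -/

open Encodable

/-- Enumeration reducibility of a set of elements of a `Primcodable` type to a set of natural
numbers, in normal form: the axioms `(a, D)` are listed by a primitive recursive function. -/
def EnumRed {α : Type*} [Primcodable α] (Y : Set α) (X : Set ℕ) : Prop :=
  ∃ f : ℕ → Option (α × List ℕ), Primrec f ∧
    ∀ a, a ∈ Y ↔ ∃ k D, f k = some (a, D) ∧ ∀ m ∈ D, m ∈ X

namespace EnumRed

variable {α β γ : Type*} [Primcodable α] [Primcodable β] [Primcodable γ] {X : Set ℕ}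

/-- Axioms may be indexed by any `Primcodable` type, a number being decoded first. An index serves
below as a certificate: the data that make membership checkable by a primitive recursive function.
-/
theorem of_certificates {Y : Set α} (f : γ → Option (α × List ℕ)) (hf : Primrec f)
    (h : ∀ a, a ∈ Y ↔ ∃ k D, f k = some (a, D) ∧ ∀ m ∈ D, m ∈ X) : EnumRed Y X := by
  refine ⟨fun k => (decode k : Option γ).bind f,
    Primrec.option_bind Primrec.decode (hf.comp Primrec.snd), fun a => (h a).trans ⟨?_, ?_⟩⟩
  · rintro ⟨k, D, h1, h2⟩
    exact ⟨encode k, D, by simpa using h1, h2⟩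
  · rintro ⟨k, D, h1, h2⟩
    obtain ⟨c, -, hc⟩ := Option.bind_eq_some_iff.1 h1
    exact ⟨c, D, hc, h2⟩

/-- Running a semidecision program for a bounded number of steps is primitive recursive, so a
candidate axiom with a step bound is a certificate. -/
theorem of_enumReducible {Y X : Set ℕ} (h : EnumReducible Y X) : EnumRed Y X := by
  obtain ⟨A, hA, hY⟩ := h
  obtain ⟨c, hc⟩ := Nat.Partrec.Code.exists_code.1 hA
  have key : ∀ p : ℕ × List ℕ, p ∈ A ↔ ∃ s, (c.evaln s (encode p)).isSome := by
    intro p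
    have h1 : p ∈ A ↔ (c.eval (encode p)).Dom := by
      rw [hc]; beta_reduce; rw [encodek]; simp [Part.assert]
    rw [h1, Part.dom_iff_mem]
    simp only [Nat.Partrec.Code.evaln_complete, Option.isSome_iff_exists, Option.mem_def]
    exact exists_comm
  refine of_certificates (γ := (ℕ × List ℕ) × ℕ)
    (fun k => (c.evaln k.2 (encode k.1)).map fun _ => k.1) ?_ fun a => ?_
  · refine Primrec.option_map (Nat.Partrec.Code.primrec_evaln.comp
      (.pair (.pair .snd (.const c)) (Primrec.encode.comp .fst))) (Primrec.fst.comp .fst)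
  · rw [hY]
    constructor
    · rintro ⟨D, h1, h2⟩
      obtain ⟨s, hs⟩ := (key _).1 h1
      obtain ⟨y, hy⟩ := Option.isSome_iff_exists.1 hs
      exact ⟨((a, D), s), D, by rw [hy]; rfl, h2⟩
    · rintro ⟨⟨p, s⟩, D, h1, h2⟩
      obtain ⟨y, hy, rfl⟩ := Option.map_eq_some_iff.1 h1
      exact ⟨D, (key _).2 ⟨s, by simp_all⟩, h2⟩

theorem enumReducible {Y X : Set ℕ} (h : EnumRed Y X) : EnumReducible Y X := by
  obtain ⟨f, hf, hY⟩ := h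
  refine ⟨{p | ∃ k, f k = some p}, ?_, fun n => (hY n).trans ?_⟩
  · have h1 : Partrec₂ fun (p : ℕ × List ℕ) (k : ℕ) =>
        (Part.some (decide (f k = some p)) : Part Bool) := by
      have : Primrec₂ fun (p : ℕ × List ℕ) (k : ℕ) => decide (f k = some p) :=
        (Primrec.eq.comp (hf.comp .snd) (Primrec.option_some.comp .fst)).decide
      exact this.to_comp.partrec
    refine (Partrec.rfind h1).dom_re.of_eq fun p => ?_
    refine Nat.rfind_dom.trans ⟨?_, ?_⟩
    · rintro ⟨k, hk, -⟩
      exact ⟨k, of_decide_eq_true (Part.mem_some_iff.1 hk).symm⟩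
    · rintro ⟨k, hk⟩
      exact ⟨k, Part.mem_some_iff.2 (decide_eq_true hk).symm, fun _ => trivial⟩
  · constructor
    · rintro ⟨k, D, h1, h2⟩; exact ⟨D, ⟨k, h1⟩, h2⟩
    · rintro ⟨D, ⟨k, h1⟩, h2⟩; exact ⟨k, D, h1, h2⟩

theorem self (X : Set ℕ) : EnumRed X X :=
  ⟨fun k => some (k, [k]),
    Primrec.option_some.comp (.pair .id (Primrec.list_cons.comp .id (.const []))),
    fun a => by simp⟩

theorem of_primrecPred {Y : Set α} (h : PrimrecPred fun a => a ∈ Y) : EnumRed Y X := by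
  classical
  refine of_certificates (γ := α) (fun a => if a ∈ Y then some (a, []) else none)
    (Primrec.ite h (Primrec.option_some.comp (.pair .id (.const []))) (.const none)) fun a => ?_
  constructor
  · intro ha; exact ⟨a, [], by simp [ha]⟩
  · rintro ⟨k, D, h1, -⟩
    by_cases hk : k ∈ Y <;> simp [hk] at h1
    rwa [← h1.1]

theorem image {Y : Set α} (h : EnumRed Y X) {g : α → β} (hg : Primrec g) :
    EnumRed (g '' Y) X := by
  obtain ⟨f, hf, hY⟩ := h
  refine ⟨fun k => (f k).map fun p => (g p.1, p.2), Primrec.option_map hf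
    (Primrec.pair (hg.comp (Primrec.fst.comp .snd)) (Primrec.snd.comp .snd)).to₂, fun b => ?_⟩
  constructor
  · rintro ⟨a, ha, rfl⟩
    obtain ⟨k, D, h1, h2⟩ := (hY a).1 ha
    exact ⟨k, D, by simp [h1], h2⟩
  · rintro ⟨k, D, h1, h2⟩
    obtain ⟨p, hp, h3⟩ := Option.map_eq_some_iff.1 h1
    obtain ⟨rfl, rfl⟩ := Prod.mk.injEq .. ▸ h3
    exact ⟨p.1, (hY _).2 ⟨k, p.2, hp, h2⟩, rfl⟩

theorem preimage {Y : Set β} (h : EnumRed Y X) {g : α → β} (hg : Primrec g) :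
    EnumRed (g ⁻¹' Y) X := by
  obtain ⟨f, hf, hY⟩ := h
  -- A certificate is the argument and the number of an axiom for its image. Codes are compared
  -- because decidable equality on `β` is not assumed.
  refine of_certificates (γ := α × ℕ) (fun c => (f c.2).bind fun p =>
    if encode p.1 = encode (g c.1) then some (c.1, p.2) else none) ?_ fun a => ?_
  · refine Primrec.option_bind (hf.comp .snd) (Primrec.ite (Primrec.eq.comp
      (Primrec.encode.comp (Primrec.fst.comp .snd))
      (Primrec.encode.comp (hg.comp (Primrec.fst.comp .fst))))
      (Primrec.option_some.comp (.pair (Primrec.fst.comp .fst) (Primrec.snd.comp .snd)))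
      (.const none))
  · rw [Set.mem_preimage, hY]
    constructor
    · rintro ⟨k, D, h1, h2⟩
      exact ⟨(a, k), D, by simp [h1], h2⟩
    · rintro ⟨⟨a', k⟩, D, h1, h2⟩
      obtain ⟨⟨b, D'⟩, hp, h3⟩ := Option.bind_eq_some_iff.1 h1
      dsimp only at h3 hp
      split_ifs at h3 with h4
      rw [encode_injective.eq_iff] at h4
      simp only [Option.some.injEq, Prod.mk.injEq] at h3
      obtain ⟨rfl, rfl⟩ := h3
      exact ⟨k, D', by rw [hp, h4], h2⟩

theorem union {Y Z : Set α} (hY : EnumRed Y X) (hZ : EnumRed Z X) : EnumRed (Y ∪ Z) X := by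
  obtain ⟨f, hf, hY⟩ := hY
  obtain ⟨g, hg, hZ⟩ := hZ
  refine of_certificates (γ := ℕ ⊕ ℕ) (Sum.elim f g)
    ((Primrec.sumCasesOn .id (hf.comp .snd).to₂ (hg.comp .snd).to₂).of_eq
      (by rintro (k | k) <;> rfl)) fun a => ?_
  simp [hY, hZ]

theorem inter {Y Z : Set α} (hY : EnumRed Y X) (hZ : EnumRed Z X) : EnumRed (Y ∩ Z) X := by
  obtain ⟨f, hf, hY⟩ := hY
  obtain ⟨g, hg, hZ⟩ := hZ
  refine of_certificates (γ := ℕ × ℕ) (fun c => (f c.1).bind fun p => (g c.2).bind fun q =>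
    if encode p.1 = encode q.1 then some (p.1, p.2 ++ q.2) else none) ?_ fun a => ?_
  · refine Primrec.option_bind (hf.comp .fst) (Primrec.option_bind
      (hg.comp (Primrec.snd.comp .fst)) (Primrec.ite (Primrec.eq.comp
      (Primrec.encode.comp (Primrec.fst.comp (Primrec.snd.comp .fst)))
      (Primrec.encode.comp (Primrec.fst.comp .snd)))
      (Primrec.option_some.comp (.pair (Primrec.fst.comp (Primrec.snd.comp .fst))
        (Primrec.list_append.comp (Primrec.snd.comp (Primrec.snd.comp .fst))
          (Primrec.snd.comp .snd))))
      (.const none)))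
  · rw [Set.mem_inter_iff, hY, hZ]
    constructor
    · rintro ⟨⟨k, D, h1, h2⟩, l, D', h3, h4⟩
      refine ⟨(k, l), D ++ D', by simp [h1, h3], fun m hm => ?_⟩
      exact (List.mem_append.1 hm).elim (h2 m) (h4 m)
    · rintro ⟨⟨k, l⟩, D, h1, h2⟩
      obtain ⟨⟨b, D1⟩, hp, h3⟩ := Option.bind_eq_some_iff.1 h1
      obtain ⟨⟨b', D2⟩, hq, h3⟩ := Option.bind_eq_some_iff.1 h3
      dsimp only at h3 hp hq
      split_ifs at h3 with h4
      rw [encode_injective.eq_iff] at h4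
      simp only [Option.some.injEq, Prod.mk.injEq] at h3
      obtain ⟨rfl, rfl⟩ := h3
      subst h4
      exact ⟨⟨k, D1, hp, fun m hm => h2 m (List.mem_append_left _ hm)⟩,
        l, D2, hq, fun m hm => h2 m (List.mem_append_right _ hm)⟩

theorem finite_list (L : List α) : EnumRed {a | a ∈ L} X := by
  refine ⟨fun k => (L[k]?).map fun a => (a, []), Primrec.option_map
    (Primrec.list_getElem?₁ L) (Primrec.pair .snd (.const [])).to₂, fun a => ?_⟩
  simp [List.mem_iff_getElem?]

/-- Only countably many sets are enumeration reducible to a given set. -/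
theorem countable_setOf (α : Type*) [Primcodable α] (X : Set ℕ) :
    {Y : Set α | EnumRed Y X}.Countable := by
  -- A reducible set is determined by a program that lists its axioms, and there are countably many
  -- programs.
  let F : Nat.Partrec.Code → Set α := fun c =>
    {a | ∃ (k : ℕ) (D : List ℕ), c.eval k = Part.some (encode (some (a, D))) ∧ ∀ m ∈ D, m ∈ X}
  refine (Set.countable_range F).mono ?_
  rintro Y ⟨f, hf, hY⟩
  obtain ⟨c, hc⟩ := Nat.Partrec.Code.exists_code.1
    (Nat.Partrec.of_primrec (Primrec.nat_iff.1 (Primrec.encode.comp hf)))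
  refine ⟨c, Set.ext fun a => ?_⟩
  rw [hY]
  simp only [F, hc, Set.mem_ofPred_eq, PFun.coe_val, Part.some_inj, encode_injective.eq_iff]

end EnumRed

/-! ### Normal closures in the free group on countably many generators -/

/-- Words in the letters `x 0, x 1, …` and their formal inverses. -/
abbrev Word := List (ℕ × Bool)

/-- The normal subgroup of the free group generated by a set of words. -/
def relClosure (E : Set Word) : Subgroup (FreeGroup ℕ) :=
  Subgroup.normalClosure (FreeGroup.mk '' E)

instance (E : Set Word) : (relClosure E).Normal := Subgroup.normalClosure_normal

theorem primrec_invRev {α : Type*} [Primcodable α] :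
    Primrec (FreeGroup.invRev : List (α × Bool) → List (α × Bool)) :=
  Primrec.list_reverse.comp (Primrec.list_map .id
    (Primrec.pair (Primrec.fst.comp .snd) (Primrec.not.comp (Primrec.snd.comp .snd))).to₂)

/-- Free reduction is a right fold in which each letter is cancelled against the head of the reduced
tail or put in front of it. Equality in the free group thus has a primitive recursive test. -/
theorem primrec_reduce {α : Type*} [Primcodable α] [DecidableEq α] :
    Primrec (FreeGroup.reduce : List (α × Bool) → List (α × Bool)) := by
  have h1 : PrimrecPred fun p : (List (α × Bool) × (α × Bool) × List (α × Bool)) ×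
      (α × Bool) × List (α × Bool) =>
      p.1.2.1.1 = p.2.1.1 ∧ p.1.2.1.2 = !p.2.1.2 := by
    refine .and (Primrec.eq.comp ?_ ?_) (Primrec.eq.comp ?_ ?_)
    · exact .comp .fst (.comp .fst (.comp .snd .fst))
    · exact .comp .fst (.comp .fst .snd)
    · exact .comp .snd (.comp .fst (.comp .snd .fst))
    · exact Primrec.not.comp (.comp .snd (.comp .fst .snd))
  have h2 : Primrec fun p : List (α × Bool) × (α × Bool) × List (α × Bool) =>
      (List.casesOn p.2.2 [p.2.1] fun hd tl =>
        if p.2.1.1 = hd.1 ∧ p.2.1.2 = !hd.2 then tl else p.2.1 :: hd :: tl :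
          List (α × Bool)) := by
    refine Primrec.list_casesOn (.comp .snd .snd)
      (Primrec.list_cons.comp (.comp .fst .snd) (.const []))
      (Primrec.ite h1 (.comp .snd .snd) <| Primrec.list_cons.comp (.comp .fst (.comp .snd .fst))
        (Primrec.list_cons.comp (.comp .fst .snd) (.comp .snd .snd))).to₂
  refine (Primrec.list_foldr .id (.const []) h2.to₂).of_eq fun L => ?_
  induction L with
  | nil => rfl
  | cons x L ih =>
    simp only [id, List.foldr_cons, FreeGroup.reduce.cons] at ih ⊢
    rw [ih]

section Certificates

variable {β : Type*} [Primcodable β]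

/-- One factor of a product of conjugates of relators and inverses of relators: `r`, or its inverse,
conjugated by `u`. -/
def conjFactor (u : Word) (ε : Bool) (r : Word) : Word :=
  u ++ (cond ε r (FreeGroup.invRev r) ++ FreeGroup.invRev u)

/-- Multiply by one more conjugate of a relator on the left, if the number `x.2.2` lists a
relator with parameter `b`. -/
def collectStep (f : ℕ → Option ((β × Word) × List ℕ)) (b : β)
    (x : Word × Bool × ℕ) (q : Word × List ℕ) : Option (Word × List ℕ) :=
  (f x.2.2).bind fun p =>
    if encode p.1.1 = encode b then some (conjFactor x.1 x.2.1 p.1.2 ++ q.1, p.2 ++ q.2) else none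

/-- The product of conjugates of relators which is described by a list, with the list of the oracle
numbers that have been used. -/
def collectRelators (f : ℕ → Option ((β × Word) × List ℕ)) (b : β)
    (L : List (Word × Bool × ℕ)) : Option (Word × List ℕ) :=
  L.foldr (fun x acc => acc.bind (collectStep f b x)) (some ([], []))

theorem primrec_conjFactor :
    Primrec fun p : Word × Bool × Word => conjFactor p.1 p.2.1 p.2.2 :=
  Primrec.list_append.comp .fst (Primrec.list_append.comp
    (Primrec.cond (.comp .fst .snd) (.comp .snd .snd) (primrec_invRev.comp (.comp .snd .snd)))
    (primrec_invRev.comp .fst))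

theorem primrec_collectStep {f : ℕ → Option ((β × Word) × List ℕ)} (hf : Primrec f) :
    Primrec fun a : β × (Word × Bool × ℕ) × Word × List ℕ => collectStep f a.1 a.2.1 a.2.2 := by
  have h1 : Primrec fun a : (β × (Word × Bool × ℕ) × Word × List ℕ) × (β × Word) × List ℕ =>
      conjFactor a.1.2.1.1 a.1.2.1.2.1 a.2.1.2 ++ a.1.2.2.1 :=
    Primrec.list_append.comp (primrec_conjFactor.comp
      (.pair (.comp .fst (.comp .fst (.comp .snd .fst)))
        (.pair (.comp .fst (.comp .snd (.comp .fst (.comp .snd .fst))))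
          (.comp .snd (.comp .fst .snd)))))
      (.comp .fst (.comp .snd (.comp .snd .fst)))
  have h2 : Primrec fun a : (β × (Word × Bool × ℕ) × Word × List ℕ) × (β × Word) × List ℕ =>
      a.2.2 ++ a.1.2.2.2 :=
    Primrec.list_append.comp (.comp .snd .snd) (.comp .snd (.comp .snd (.comp .snd .fst)))
  have h3 : PrimrecPred fun a : (β × (Word × Bool × ℕ) × Word × List ℕ) × (β × Word) × List ℕ =>
      encode a.2.1.1 = encode a.1.1 :=
    Primrec.eq.comp (Primrec.encode.comp (.comp .fst (.comp .fst .snd)))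
      (Primrec.encode.comp (.comp .fst .fst))
  exact Primrec.option_bind (hf.comp (.comp .snd (.comp .snd (.comp .fst .snd))))
    (Primrec.ite h3 (Primrec.option_some.comp (.pair h1 h2)) (.const none)).to₂

theorem primrec_collectRelators {f : ℕ → Option ((β × Word) × List ℕ)} (hf : Primrec f) :
    Primrec₂ (collectRelators f) := by
  have h : Primrec₂ fun (a : β × List (Word × Bool × ℕ))
      (x : (Word × Bool × ℕ) × Option (Word × List ℕ)) =>
      x.2.bind (collectStep f a.1 x.1) :=
    Primrec.option_bind (.comp .snd .snd) ((primrec_collectStep hf).comp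
      (.pair (.comp .fst (.comp .fst .fst)) (.pair (.comp .fst (.comp .snd .fst)) .snd))).to₂
  exact Primrec.list_foldr .snd (.const _) h

theorem mk_conjFactor (u : Word) (ε : Bool) (r : Word) :
    FreeGroup.mk (conjFactor u ε r) =
      FreeGroup.mk u * cond ε (FreeGroup.mk r) (FreeGroup.mk r)⁻¹ * (FreeGroup.mk u)⁻¹ := by
  cases ε <;> simp [conjFactor, FreeGroup.inv_mk, FreeGroup.mul_mk]

/-- Soundness of certificates: every factor used is a conjugate of a relator or of its inverse. -/
theorem mk_mem_of_collectRelators {f : ℕ → Option ((β × Word) × List ℕ)} {b : β} {X : Set ℕ}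
    {Y : Set (β × Word)} (hY : ∀ a, a ∈ Y ↔ ∃ k D, f k = some (a, D) ∧ ∀ m ∈ D, m ∈ X)
    (L : List (Word × Bool × ℕ)) {v : Word} {D : List ℕ}
    (h : collectRelators f b L = some (v, D)) (hD : ∀ m ∈ D, m ∈ X) :
    FreeGroup.mk v ∈ relClosure {r | (b, r) ∈ Y} := by
  induction L generalizing v D with
  | nil =>
    simp only [collectRelators, List.foldr_nil, Option.some.injEq, Prod.mk.injEq] at h
    rw [← h.1]
    exact one_mem _
  | cons x L ih =>
    obtain ⟨⟨v', D'⟩, h1, h2⟩ := Option.bind_eq_some_iff.1 h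
    obtain ⟨⟨⟨b', r⟩, D2⟩, h3, h4⟩ := Option.bind_eq_some_iff.1 h2
    dsimp only at h4
    split_ifs at h4 with h5
    rw [encode_injective.eq_iff] at h5
    simp only [Option.some.injEq, Prod.mk.injEq] at h4
    obtain ⟨rfl, rfl⟩ := h4
    subst h5
    rw [← FreeGroup.mul_mk, mk_conjFactor]
    refine mul_mem ?_ (ih h1 fun m hm => hD m (List.mem_append_right _ hm))
    have hr : FreeGroup.mk r ∈ relClosure {r | (b', r) ∈ Y} :=
      Subgroup.subset_normalClosure ⟨r, (hY _).2 ⟨_, _, h3, fun m hm =>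
        hD m (List.mem_append_left _ hm)⟩, rfl⟩
    refine Subgroup.Normal.conj_mem inferInstance _ ?_ _
    cases x.2.1
    · exact inv_mem hr
    · exact hr

/-- Completeness of certificates: the normal closure is generated by the conjugates of relators, and
left induction on the closure prepends one factor at a time. -/
theorem exists_collectRelators {f : ℕ → Option ((β × Word) × List ℕ)} {b : β} {X : Set ℕ}
    {Y : Set (β × Word)} (hY : ∀ a, a ∈ Y ↔ ∃ k D, f k = some (a, D) ∧ ∀ m ∈ D, m ∈ X)
    {g : FreeGroup ℕ} (hg : g ∈ relClosure {r | (b, r) ∈ Y}) :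
    ∃ L v D, collectRelators f b L = some (v, D) ∧ (∀ m ∈ D, m ∈ X) ∧ FreeGroup.mk v = g := by
  have step : ∀ (ε : Bool) (x y : FreeGroup ℕ),
      x ∈ Group.conjugatesOfSet (FreeGroup.mk '' {r | (b, r) ∈ Y}) →
      (∃ L v D, collectRelators f b L = some (v, D) ∧ (∀ m ∈ D, m ∈ X) ∧ FreeGroup.mk v = y) →
      ∃ L v D, collectRelators f b L = some (v, D) ∧ (∀ m ∈ D, m ∈ X) ∧
        FreeGroup.mk v = cond ε x x⁻¹ * y := by
    rintro ε x y hx ⟨L, v, D, h1, h2, rfl⟩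
    obtain ⟨_, ⟨r, hr, rfl⟩, hc⟩ := Group.mem_conjugatesOfSet_iff.1 hx
    obtain ⟨u, rfl⟩ := isConj_iff.1 hc
    obtain ⟨u, rfl⟩ : ∃ w : Word, FreeGroup.mk w = u := ⟨u.toWord, FreeGroup.mk_toWord⟩
    obtain ⟨k, D', h3, h4⟩ := (hY _).1 hr
    refine ⟨(u, ε, k) :: L, conjFactor u ε r ++ v, D' ++ D, ?_, fun m hm =>
      (List.mem_append.1 hm).elim (h4 m) (h2 m), ?_⟩
    · rw [collectRelators, List.foldr_cons]
      rw [collectRelators] at h1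
      rw [h1]
      simp [collectStep, h3]
    · rw [← FreeGroup.mul_mk, mk_conjFactor]
      cases ε <;> simp
  refine Subgroup.closure_induction_left (p := fun g _ => ∃ L v D,
    collectRelators f b L = some (v, D) ∧ (∀ m ∈ D, m ∈ X) ∧ FreeGroup.mk v = g)
    ⟨[], [], [], rfl, by simp, rfl⟩ (fun x hx y _ h => step true x y hx h)
    (fun x hx y _ h => step false x y hx h) hg

/-- Normal closures are enumeration reducible to the relators, uniformly in a parameter. -/
theorem EnumRed.relClosure {X : Set ℕ} {Y : Set (β × Word)} (h : EnumRed Y X) :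
    EnumRed {p : β × Word | FreeGroup.mk p.2 ∈ relClosure {r | (p.1, r) ∈ Y}} X := by
  obtain ⟨f, hf, hY⟩ := h
  -- The certificate is the word with a list of conjugators, signs and axiom numbers. The product
  -- they describe is compared with the word after free reduction.
  refine of_certificates (γ := (β × Word) × List (Word × Bool × ℕ)) (fun c =>
    (collectRelators f c.1.1 c.2).bind fun q =>
      if FreeGroup.reduce q.1 = FreeGroup.reduce c.1.2 then some (c.1, q.2) else none) ?_ ?_
  · refine Primrec.option_bind ((primrec_collectRelators hf).comp (.comp .fst .fst) .snd)
      (Primrec.ite (Primrec.eq.comp (primrec_reduce.comp (.comp .fst .snd))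
        (primrec_reduce.comp (.comp .snd (.comp .fst .fst))))
        (Primrec.option_some.comp (.pair (.comp .fst .fst) (.comp .snd .snd))) (.const none))
  · rintro ⟨b, w⟩
    constructor
    · intro hw
      obtain ⟨L, v, D, h1, h2, h3⟩ := exists_collectRelators hY hw
      exact ⟨((b, w), L), D, by simp [h1, FreeGroup.reduce.sound h3], h2⟩
    · rintro ⟨⟨p, L⟩, D, h1, h2⟩
      obtain ⟨⟨v, D'⟩, h3, h4⟩ := Option.bind_eq_some_iff.1 h1
      dsimp only at h4
      split_ifs at h4 with h5
      simp only [Option.some.injEq, Prod.mk.injEq] at h4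
      obtain ⟨rfl, rfl⟩ := h4
      have := mk_mem_of_collectRelators hY L h3 h2
      rwa [FreeGroup.reduce.exact h5] at this

end Certificates

/-! ### Evaluation of words -/

section EvalWord

variable {ι κ H K : Type*} [Group H] [Group K]

/-- The value of a word in the letters `ι` and their formal inverses. -/
def evalWord (α : ι → H) (w : List (ι × Bool)) : H :=
  (w.map fun x => cond x.2 (α x.1) (α x.1)⁻¹).prod

/-- Rename the letters of a word. -/
def relabelWord (f : ι → κ) (w : List (ι × Bool)) : List (κ × Bool) :=
  w.map (Prod.map f id)

theorem evalWord_eq_lift (α : ι → H) (w : List (ι × Bool)) :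
    evalWord α w = FreeGroup.lift α (FreeGroup.mk w) := by
  rw [FreeGroup.lift_mk, evalWord]

theorem evalWord_relabelWord (α : κ → H) (f : ι → κ) (w : List (ι × Bool)) :
    evalWord α (relabelWord f w) = evalWord (α ∘ f) w := by
  simp [evalWord, relabelWord, Function.comp_def]

theorem evalWord_congr {α β : ι → H} {w : List (ι × Bool)} (h : ∀ p ∈ w, α p.1 = β p.1) :
    evalWord α w = evalWord β w := by
  unfold evalWord
  congr 1
  exact List.map_congr_left fun p hp => by rw [h p hp]

theorem map_evalWord (f : H →* K) (α : ι → H) (w : List (ι × Bool)) :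
    f (evalWord α w) = evalWord (f ∘ α) w := by
  rw [evalWord_eq_lift, evalWord_eq_lift]
  exact DFunLike.congr_fun (FreeGroup.ext_hom (f.comp (FreeGroup.lift α))
    (FreeGroup.lift (f ∘ α)) fun i => by simp) _

theorem evalWord_append (α : ι → H) (v w : List (ι × Bool)) :
    evalWord α (v ++ w) = evalWord α v * evalWord α w := by
  simp [evalWord]

theorem evalWord_invRev (α : ι → H) (w : List (ι × Bool)) :
    evalWord α (FreeGroup.invRev w) = (evalWord α w)⁻¹ := by
  rw [evalWord_eq_lift, evalWord_eq_lift, ← FreeGroup.inv_mk, map_inv]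

theorem evalWord_of (w : List (ι × Bool)) :
    evalWord (fun i => FreeGroup.of i) w = FreeGroup.mk w := by
  rw [evalWord_eq_lift]
  exact DFunLike.congr_fun (FreeGroup.lift_of_eq_id ι) _

theorem evalWord_quotient (N : Subgroup (FreeGroup ι)) [N.Normal] (w : List (ι × Bool)) :
    evalWord (fun i => (FreeGroup.of i : FreeGroup ι ⧸ N)) w = (FreeGroup.mk w : FreeGroup ι) := by
  rw [← evalWord_of]
  exact (map_evalWord (QuotientGroup.mk' N) _ w).symm

/-- The kernel of evaluation is normal and contains the relators. Consistency is always proved by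
exhibiting a group and an assignment to which this applies. -/
theorem evalWord_eq_one_of_mem_relClosure {E : Set Word} {α : ℕ → H}
    (hE : ∀ r ∈ E, evalWord α r = 1) {w : Word} (hw : FreeGroup.mk w ∈ relClosure E) :
    evalWord α w = 1 := by
  rw [evalWord_eq_lift]
  have : relClosure E ≤ (FreeGroup.lift α).ker := by
    refine Subgroup.normalClosure_le_normal ?_
    rintro _ ⟨r, hr, rfl⟩
    rw [SetLike.mem_coe, MonoidHom.mem_ker, ← evalWord_eq_lift]
    exact hE r hr
  exact this hw

end EvalWord

/-- All letters of the word have an index below `b`. -/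
def LettersBelow (b : ℕ) (w : Word) : Prop := ∀ p ∈ w, p.1 < b

theorem LettersBelow.mono {b c : ℕ} (h : b ≤ c) {w : Word} (hw : LettersBelow b w) :
    LettersBelow c w := fun p hp => (hw p hp).trans_le h

theorem relClosure_mono {E F : Set Word} (h : E ⊆ F) : relClosure E ≤ relClosure F :=
  Subgroup.normalClosure_mono (Set.image_mono h)

theorem mk_mem_relClosure {E : Set Word} {w : Word} (h : w ∈ E) :
    FreeGroup.mk w ∈ relClosure E :=
  Subgroup.subset_normalClosure ⟨w, h, rfl⟩

/-! ### Existentially closed quotients of the free group -/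

/-- Words in parameters `Sum.inl i` and variables `Sum.inr j`. -/
abbrev SysWord := List ((ℕ ⊕ ℕ) × Bool)

/-- Interpret the parameter `i` as the letter `i` and the variable `j` as the letter `b + j`. -/
def instWord (b : ℕ) : SysWord → Word := relabelWord (Sum.elim id (b + ·))

-- Once parameters have representing words, a term reads as a word. The same word works in all
-- groups at once, so values in a larger group and in the quotient can be compared.
open FirstOrder Language in
theorem exists_sysWord_term {M : Type} {n : ℕ} (rep : M → Word)
    (t : groupLanguage.Term ((M ⊕ Fin n) ⊕ Fin 0)) :
    ∃ w : SysWord, ∀ (H : Type) [Group H] (α β : ℕ → H) (v : M ⊕ Fin n → H) (xs : Fin 0 → H),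
      (∀ m, v (.inl m) = evalWord α (rep m)) → (∀ j, v (.inr j) = β j) →
        t.realize (Sum.elim v xs) = evalWord (Sum.elim α β) w := by
  induction t with
  | var x =>
    rcases x with (m | j) | j
    · refine ⟨relabelWord Sum.inl (rep m), fun H _ α β v xs h1 h2 => ?_⟩
      rw [evalWord_relabelWord]
      exact h1 m
    · exact ⟨[(.inr j, true)], fun H _ α β v xs h1 h2 => by simp [evalWord, h2]⟩
    · exact j.elim0
  | func f ts ih =>
    choose w hw using ih
    cases f with
    | one => exact ⟨[], fun H _ α β v xs h1 h2 => rfl⟩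
    | inv =>
      refine ⟨FreeGroup.invRev (w 0), fun H _ α β v xs h1 h2 => ?_⟩
      rw [evalWord_invRev, ← hw 0 H α β v xs h1 h2]
      rfl
    | mul =>
      refine ⟨w 0 ++ w 1, fun H _ α β v xs h1 h2 => ?_⟩
      rw [evalWord_append, ← hw 0 H α β v xs h1 h2, ← hw 1 H α β v xs h1 h2]
      rfl

open FirstOrder Language in
/-- The truth value of a quantifier-free formula depends only on which of finitely many words are
trivial. -/
theorem exists_sysWords_of_isQF {M : Type} {n : ℕ} (rep : M → Word)
    {φ : groupLanguage.BoundedFormula (M ⊕ Fin n) 0} (hφ : φ.IsQF) :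
    ∃ L : List SysWord, ∀ (H₁ H₂ : Type) [Group H₁] [Group H₂] (α₁ β₁ : ℕ → H₁)
      (α₂ β₂ : ℕ → H₂)
      (v₁ : M ⊕ Fin n → H₁) (v₂ : M ⊕ Fin n → H₂) (xs₁ : Fin 0 → H₁) (xs₂ : Fin 0 → H₂),
      (∀ m, v₁ (.inl m) = evalWord α₁ (rep m)) → (∀ j, v₁ (.inr j) = β₁ j) →
      (∀ m, v₂ (.inl m) = evalWord α₂ (rep m)) → (∀ j, v₂ (.inr j) = β₂ j) →
      (∀ w ∈ L, evalWord (Sum.elim α₁ β₁) w = 1 ↔ evalWord (Sum.elim α₂ β₂) w = 1) →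
        (φ.Realize v₁ xs₁ ↔ φ.Realize v₂ xs₂) := by
  induction hφ with
  | falsum => exact ⟨[], fun _ _ _ _ _ _ _ _ _ _ _ _ _ _ _ _ _ => Iff.rfl⟩
  | of_isAtomic h =>
    cases h with
    | equal s t =>
      obtain ⟨ws, hs⟩ := exists_sysWord_term rep s
      obtain ⟨wt, ht⟩ := exists_sysWord_term rep t
      refine ⟨[ws ++ FreeGroup.invRev wt],
        fun H₁ H₂ _ _ α₁ β₁ α₂ β₂ v₁ v₂ xs₁ xs₂ h1 h2 h3 h4 h => ?_⟩
      have := h _ (List.mem_singleton_self _)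
      simp only [evalWord_append, evalWord_invRev, mul_inv_eq_one] at this
      rwa [BoundedFormula.realize_bdEqual, BoundedFormula.realize_bdEqual,
        hs H₁ α₁ β₁ v₁ xs₁ h1 h2, ht H₁ α₁ β₁ v₁ xs₁ h1 h2,
        hs H₂ α₂ β₂ v₂ xs₂ h3 h4, ht H₂ α₂ β₂ v₂ xs₂ h3 h4]
    | rel R ts => exact R.elim
  | imp _ _ ih₁ ih₂ =>
    obtain ⟨L₁, h₁⟩ := ih₁
    obtain ⟨L₂, h₂⟩ := ih₂
    refine ⟨L₁ ++ L₂, fun H₁ H₂ _ _ α₁ β₁ α₂ β₂ v₁ v₂ xs₁ xs₂ a b c d h => ?_⟩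
    rw [BoundedFormula.realize_imp, BoundedFormula.realize_imp,
      h₁ H₁ H₂ α₁ β₁ α₂ β₂ v₁ v₂ xs₁ xs₂ a b c d fun w hw => h w (List.mem_append_left _ hw),
      h₂ H₁ H₂ α₁ β₁ α₂ β₂ v₁ v₂ xs₁ xs₂ a b c d fun w hw => h w (List.mem_append_right _ hw)]

/-- A quotient of the free group is existentially closed if systems of equations and inequations
that have a solution in a larger group are solved by some of the generators. -/
theorem isExistentiallyClosedGroup_quotient (N : Subgroup (FreeGroup ℕ)) [N.Normal]
    (h : ∀ (E I : List SysWord) (H : Type) [Group H] (α β : ℕ → H),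
      (∀ w : Word, FreeGroup.mk w ∈ N ↔ evalWord α w = 1) →
      (∀ w ∈ E, evalWord (Sum.elim α β) w = 1) → (∀ w ∈ I, evalWord (Sum.elim α β) w ≠ 1) →
      ∃ b, (∀ w ∈ E, FreeGroup.mk (instWord b w) ∈ N) ∧
        ∀ w ∈ I, FreeGroup.mk (instWord b w) ∉ N) :
    IsExistentiallyClosedGroup (FreeGroup ℕ ⧸ N) := by
  classical
  intro n φ hφ H _ j hj ⟨s, hs⟩
  have hrep : ∀ m : FreeGroup ℕ ⧸ N, ∃ w : Word,
      ((FreeGroup.mk w : FreeGroup ℕ) : FreeGroup ℕ ⧸ N) = m := by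
    intro m
    induction m using QuotientGroup.induction_on with
    | H z => exact ⟨z.toWord, by rw [FreeGroup.mk_toWord]⟩
  choose rep hrep using hrep
  obtain ⟨L, hL⟩ := exists_sysWords_of_isQF rep hφ
  let x : ℕ → FreeGroup ℕ ⧸ N := fun i => (FreeGroup.of i : FreeGroup ℕ)
  let β : ℕ → H := fun i => if hi : i < n then s ⟨i, hi⟩ else 1
  -- The system records which of the decisive words are trivial at the given solution. Generators
  -- with the same pattern give the formula the same truth value.
  obtain ⟨b, hb1, hb2⟩ := h (L.filter fun w => evalWord (Sum.elim (j ∘ x) β) w = 1)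
    (L.filter fun w => evalWord (Sum.elim (j ∘ x) β) w ≠ 1) H (j ∘ x) β
    (fun w => by
      rw [← map_evalWord, map_eq_one_iff j hj, evalWord_quotient, QuotientGroup.eq_one_iff])
    (by simp) (by simp)
  have hinst : ∀ w : SysWord, evalWord (Sum.elim x fun i => x (b + i)) w = 1 ↔
      FreeGroup.mk (instWord b w) ∈ N := by
    intro w
    rw [← QuotientGroup.eq_one_iff, ← evalWord_quotient, instWord, evalWord_relabelWord]
    have : (fun i => ((FreeGroup.of i : FreeGroup ℕ) : FreeGroup ℕ ⧸ N)) ∘ Sum.elim id (b + ·) =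
        Sum.elim x fun i => x (b + i) := by
      ext (i | i) <;> rfl
    rw [this]
  refine ⟨fun i => x (b + i), (hL H (FreeGroup ℕ ⧸ N) (j ∘ x) β x (fun i => x (b + i))
    (Sum.elim j s) (Sum.elim id fun i => x (b + i)) _ _ (fun m => ?_) (fun i => ?_) (fun m => ?_)
    (fun i => ?_) fun w hw => ?_).1 hs⟩
  · rw [← map_evalWord, evalWord_quotient, hrep, Sum.elim_inl]
  · simp [β]
  · rw [evalWord_quotient, hrep, Sum.elim_inl, id]
  · simp
  · rw [hinst]
    by_cases h1 : evalWord (Sum.elim (j ∘ x) β) w = 1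
    · simp only [h1, true_iff]
      exact hb1 w (List.mem_filter.2 ⟨hw, by simpa using h1⟩)
    · simp only [h1, false_iff]
      exact hb2 w (List.mem_filter.2 ⟨hw, by simpa using h1⟩)

/-- No word of `I` is a consequence of the relators `E`. -/
def ConsistentRel (E I : Set Word) : Prop := ∀ w ∈ I, FreeGroup.mk w ∉ relClosure E

theorem ConsistentRel.mono {E E' I I' : Set Word} (h : ConsistentRel E' I') (hE : E ⊆ E')
    (hI : I ⊆ I') : ConsistentRel E I :=
  fun w hw hm => h w (hI hw) (relClosure_mono hE hm)

/-- The union of a chain of normal subgroups is a normal subgroup, so a consequence of all relators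
follows already at some stage. -/
theorem mem_relClosure_iUnion {E : ℕ → Set Word} (hE : Monotone E) {g : FreeGroup ℕ} :
    g ∈ relClosure (⋃ s, E s) ↔ ∃ s, g ∈ relClosure (E s) := by
  constructor
  · intro h
    have hdir : Directed (· ≤ ·) fun s => relClosure (E s) :=
      directed_of_isDirected_le fun s t hst => relClosure_mono (hE hst)
    rw [← Subgroup.mem_iSup_of_directed hdir]
    have : (⨆ s, relClosure (E s)).Normal := by
      refine ⟨fun n hn g => ?_⟩
      rw [Subgroup.mem_iSup_of_directed hdir] at hn ⊢
      exact hn.imp fun s hs => Subgroup.Normal.conj_mem inferInstance _ hs _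
    refine Subgroup.normalClosure_le_normal ?_ h
    rintro _ ⟨w, hw, rfl⟩
    obtain ⟨s, hs⟩ := Set.mem_iUnion.1 hw
    exact (le_iSup (fun s => relClosure (E s)) s) (mk_mem_relClosure hs)
  · rintro ⟨s, hs⟩
    exact relClosure_mono (Set.subset_iUnion E s) hs

theorem consistentRel_iUnion {E I : ℕ → Set Word} (hE : Monotone E) (hI : Monotone I)
    (h : ∀ s, ConsistentRel (E s) (I s)) : ConsistentRel (⋃ s, E s) (⋃ s, I s) := by
  intro w hw hm
  obtain ⟨s, hs⟩ := Set.mem_iUnion.1 hw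
  obtain ⟨t, ht⟩ := (mem_relClosure_iUnion hE).1 hm
  exact h (max s t) w (hI (le_max_left s t) hs) (relClosure_mono (hE (le_max_right s t)) ht)

/-- The limit of an increasing sequence of consistent sets of equations and inequations is
existentially closed if every system whose addition is consistent has been added at some stage. -/
theorem isExistentiallyClosedGroup_of_stages {E I : ℕ → Set Word} (hE : Monotone E)
    (hI : Monotone I) (hc : ∀ s, ConsistentRel (E s) (I s))
    (h : ∀ A B : List SysWord, ∃ s b, (∀ w ∈ E s ∪ I s, LettersBelow b w) ∧
      (∀ w ∈ A ++ B, ∀ p ∈ w, ∀ i, p.1 = Sum.inl i → i < b) ∧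
      (ConsistentRel (E s ∪ {v | ∃ w ∈ A, instWord b w = v})
        (I s ∪ {v | ∃ w ∈ B, instWord b w = v}) →
        (∀ w ∈ A, instWord b w ∈ E (s + 1)) ∧ ∀ w ∈ B, instWord b w ∈ I (s + 1))) :
    IsExistentiallyClosedGroup (FreeGroup ℕ ⧸ relClosure (⋃ s, E s)) := by
  have hcons := consistentRel_iUnion hE hI hc
  refine isExistentiallyClosedGroup_quotient _ fun A B H _ α β hα hA hB => ?_
  obtain ⟨s, b, hb, hp, hadd⟩ := h A B
  -- Old letters keep their value in `H`, and the fresh letters from `b` on receive the solution.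
  let γ : ℕ → H := fun i => if i < b then α i else β (i - b)
  have hγ : ∀ w ∈ E s ∪ I s, evalWord γ w = evalWord α w := fun w hw =>
    evalWord_congr fun p hp => if_pos (hb w hw p hp)
  have hγ' : ∀ w ∈ A ++ B, evalWord γ (instWord b w) = evalWord (Sum.elim α β) w := by
    intro w hw
    rw [instWord, evalWord_relabelWord]
    refine evalWord_congr fun p hpw => ?_
    rcases hq : p.1 with i | i
    · simp [γ, hp w hw p hpw i hq]
    · simp [γ]
  have hE' : ∀ r ∈ E s ∪ {v | ∃ w ∈ A, instWord b w = v}, evalWord γ r = 1 := by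
    rintro r (hr | ⟨w, hw, rfl⟩)
    · rw [hγ r (.inl hr), ← hα]
      exact mk_mem_relClosure (Set.mem_iUnion.2 ⟨s, hr⟩)
    · rw [hγ' w (List.mem_append_left _ hw)]
      exact hA w hw
  -- Consistency of the addition: `γ` satisfies all relators in `H` but makes none of the forbidden
  -- words trivial.
  obtain ⟨h1, h2⟩ := hadd (by
    rintro r (hr | ⟨w, hw, rfl⟩) hm
    · have := evalWord_eq_one_of_mem_relClosure hE' hm
      rw [hγ r (.inr hr), ← hα] at this
      exact hcons r (Set.mem_iUnion.2 ⟨s, hr⟩) this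
    · have := evalWord_eq_one_of_mem_relClosure hE' hm
      rw [hγ' w (List.mem_append_right _ hw)] at this
      exact hB w hw this)
  exact ⟨b, fun w hw => mk_mem_relClosure (Set.mem_iUnion.2 ⟨s + 1, h1 w hw⟩),
    fun w hw => hcons _ (Set.mem_iUnion.2 ⟨s + 1, h2 w hw⟩)⟩

/-! ### Bounds for letters -/

/-- The code of a list exceeds those of its members, so it is a primitive recursive bound for all
letters that occur in it. -/
theorem encode_lt_encode_of_mem {α : Type*} [Encodable α] {a : α} {l : List α} (h : a ∈ l) :
    encode a < encode l := by
  induction l with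
  | nil => simp at h
  | cons x l ih =>
    rw [encode_list_cons, Nat.lt_succ_iff]
    rcases List.mem_cons.1 h with rfl | h
    · exact Nat.left_le_pair _ _
    · exact (ih h).le.trans (Nat.right_le_pair _ _)

theorem encode_fst_le {α β : Type*} [Encodable α] [Encodable β] (p : α × β) :
    encode p.1 ≤ encode p := by
  rw [encode_prod_val]; exact Nat.left_le_pair _ _

theorem lettersBelow_encode {L : List Word} {w : Word} (hw : w ∈ L) :
    LettersBelow (encode L) w := fun p hp =>
  (encode_fst_le p).trans_lt ((encode_lt_encode_of_mem hp).trans (encode_lt_encode_of_mem hw))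

theorem param_lt_encode {L : List SysWord} {w : SysWord} (hw : w ∈ L) :
    ∀ p ∈ w, ∀ i, p.1 = Sum.inl i → i < encode L := fun p hp i hi => by
  have h1 : i ≤ encode p.1 := by
    rw [hi, encode_inl, encode_nat]; lia
  exact h1.trans_lt ((encode_fst_le p).trans_lt
    ((encode_lt_encode_of_mem hp).trans (encode_lt_encode_of_mem hw)))

/-! ### Embeddings of finitely generated groups -/

/-- Evaluation at `f` is onto `F` and has the same kernel as evaluation at `m`, so the second
evaluation descends to an injective map on `F`. -/
theorem exists_injective_hom_of_evalWord_iff {F M ι : Type*} [Group F] [Group M] {f : ι → F}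
    (hf : Subgroup.closure (Set.range f) = ⊤) (m : ι → M)
    (h : ∀ w : List (ι × Bool), evalWord f w = 1 ↔ evalWord m w = 1) :
    ∃ i : F →* M, Function.Injective i := by
  have hs : Function.Surjective (FreeGroup.lift f) := by
    rw [← MonoidHom.range_eq_top, FreeGroup.range_lift_eq_closure, hf]
  have hker : ∀ x : FreeGroup ι, FreeGroup.lift f x = 1 ↔ FreeGroup.lift m x = 1 := by
    classical
    intro x
    have := h x.toWord
    rwa [evalWord_eq_lift, evalWord_eq_lift, FreeGroup.mk_toWord] at this
  have hle : (FreeGroup.lift f).ker ≤ (FreeGroup.lift m).ker := fun x hx => (hker x).1 hx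
  refine ⟨(FreeGroup.lift f).liftOfSurjective hs ⟨FreeGroup.lift m, hle⟩, ?_⟩
  rw [injective_iff_map_eq_one]
  intro a ha
  obtain ⟨x, rfl⟩ := hs a
  have : (FreeGroup.lift f).liftOfSurjective hs ⟨FreeGroup.lift m, hle⟩ (FreeGroup.lift f x) =
      FreeGroup.lift m x := MonoidHom.liftOfRightInverse_comp_apply _ _ _ ⟨FreeGroup.lift m, hle⟩ x
  rw [this] at ha
  exact (hker x).2 ha

/-- Substitute words for the letters of a word. -/
def substWord {ι κ : Type*} (u : ι → List (κ × Bool)) (w : List (ι × Bool)) : List (κ × Bool) :=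
  w.flatMap fun p => cond p.2 (u p.1) (FreeGroup.invRev (u p.1))

theorem evalWord_substWord {ι κ H : Type*} [Group H] (u : ι → List (κ × Bool)) (α : κ → H)
    (w : List (ι × Bool)) :
    evalWord α (substWord u w) = evalWord (fun i => evalWord α (u i)) w := by
  induction w with
  | nil => rfl
  | cons p w ih =>
    rw [substWord, List.flatMap_cons, evalWord_append, ← substWord, ih]
    rcases p with ⟨i, _ | _⟩
    · simpa [evalWord] using evalWord_invRev α (u i)
    · simp [evalWord]

/-- A function on a finite type is primitive recursive, hence nothing has to be assumed about `u`.
-/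
theorem primrec_substWord {ι κ : Type*} [Finite ι] [Primcodable ι] [Primcodable κ]
    (u : ι → List (κ × Bool)) : Primrec (substWord u) :=
  Primrec.list_flatMap .id
    ((Primrec.dom_finite fun p : ι × Bool => cond p.2 (u p.1) (FreeGroup.invRev (u p.1))).comp
      .snd).to₂

theorem primrec_relabelWord {ι κ : Type*} [Primcodable ι] [Primcodable κ] {f : ι → κ}
    (hf : Primrec f) : Primrec (relabelWord f) :=
  Primrec.list_map .id (Primrec.pair (hf.comp (.comp .fst .snd)) (.comp .snd .snd)).to₂

theorem enumReducible_wordProblem_iff {F : Type*} [Group F] {k : ℕ} (f : Fin k → F) (X : Set ℕ) :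
    EnumReducible (wordProblem f) X ↔ EnumRed {w | evalWord f w = 1} X := by
  have himage : wordProblem f = encode '' {w : List (Fin k × Bool) | evalWord f w = 1} := by
    ext m
    exact ⟨fun ⟨w, h1, h2⟩ => ⟨w, h2, h1⟩, fun ⟨w, h1, h2⟩ => ⟨w, h2, h1⟩⟩
  constructor
  · intro h
    convert (EnumRed.of_enumReducible h).preimage
      (Primrec.encode : Primrec (encode : List (Fin k × Bool) → ℕ))
    rw [himage, Set.preimage_image_eq _ encode_injective]
  · intro h
    rw [himage]
    exact (h.image Primrec.encode).enumReducible

theorem EnumRed.mk_mem_relClosure {E : Set Word} {X : Set ℕ} (h : EnumRed E X) :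
    EnumRed {w : Word | FreeGroup.mk w ∈ _root_.relClosure E} X := by
  have h1 : EnumRed {p : Unit × Word | p.2 ∈ E} X := h.preimage Primrec.snd
  exact h1.relClosure.preimage (g := fun w => ((), w)) (.pair (.const ()) .id)

/-! ### Stages given by relators which are enumeration reducible to a set -/

/-- A set of relators in letters below a bound, which is enumeration reducible to `X`. -/
structure EnumStage (X : Set ℕ) where
  /-- the relators -/
  rel : Set Word
  /-- the bound for the letters -/
  bound : ℕ
  enumRed : EnumRed rel X
  lettersBelow : ∀ w ∈ rel, LettersBelow bound w

namespace EnumStage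

variable {X : Set ℕ}

/-- The words below the bound which do not follow from the relators. -/
def nonrel (p : EnumStage X) : Set Word :=
  {w | LettersBelow p.bound w ∧ FreeGroup.mk w ∉ relClosure p.rel}

/-- The stage `q` has more relators than `p`, but no new consequences in the letters of `p`. -/
structure Extends (p q : EnumStage X) : Prop where
  rel_subset : p.rel ⊆ q.rel
  bound_lt : p.bound < q.bound
  nonrel_subset : p.nonrel ⊆ q.nonrel

theorem consistentRel (p : EnumStage X) : ConsistentRel p.rel p.nonrel := fun _ hw => hw.2

/-- The case distinction on consistency is not effective. In the inconsistent case only the bound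
grows; in the consistent case consistency itself says that no old nonrelator becomes a consequence.
-/
theorem exists_extends_system (p : EnumStage X) (A B : List SysWord) :
    ∃ q : EnumStage X, p.Extends q ∧ ∃ b, (∀ w ∈ p.rel ∪ p.nonrel, LettersBelow b w) ∧
      (∀ w ∈ A ++ B, ∀ p ∈ w, ∀ i, p.1 = Sum.inl i → i < b) ∧
      (ConsistentRel (p.rel ∪ {v | ∃ w ∈ A, instWord b w = v})
        (p.nonrel ∪ {v | ∃ w ∈ B, instWord b w = v}) →
        (∀ w ∈ A, instWord b w ∈ q.rel) ∧ ∀ w ∈ B, instWord b w ∈ q.nonrel) := by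
  -- This is at least the old bound and lies above all parameters of the system, so the letters from
  -- `b` on are fresh.
  obtain ⟨b, hb⟩ : ∃ b, b = p.bound + encode (A ++ B) := ⟨_, rfl⟩
  have hb1 : ∀ w ∈ p.rel ∪ p.nonrel, LettersBelow b w := fun w hw =>
    LettersBelow.mono (by lia) (hw.elim (p.lettersBelow w) fun h => h.1)
  have hb2 : ∀ w ∈ A ++ B, ∀ p ∈ w, ∀ i, p.1 = Sum.inl i → i < b := fun w hw q hq i hi =>
    (param_lt_encode hw q hq i hi).trans_le (by lia)
  by_cases hc : ConsistentRel (p.rel ∪ {v | ∃ w ∈ A, instWord b w = v})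
      (p.nonrel ∪ {v | ∃ w ∈ B, instWord b w = v})
  -- The new bound must exceed every letter of the instances, so that the new inequations count
  -- among `nonrel`.
  · obtain ⟨c, hcdef⟩ : ∃ c, c = p.bound + 1 + encode ((A ++ B).map (instWord b)) := ⟨_, rfl⟩
    have hcb : ∀ w ∈ A ++ B, LettersBelow c (instWord b w) := fun w hw =>
      (lettersBelow_encode (List.mem_map_of_mem hw)).mono (by lia)
    refine ⟨⟨p.rel ∪ {v | ∃ w ∈ A, instWord b w = v}, c, ?_, ?_⟩, ⟨?_, ?_, ?_⟩, b, hb1, hb2,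
      fun _ => ⟨?_, ?_⟩⟩
    · refine p.enumRed.union ?_
      convert EnumRed.finite_list (X := X) (A.map (instWord b)) using 1
      ext v
      simp
    · rintro w (hw | ⟨w, hw, rfl⟩)
      · exact (p.lettersBelow w hw).mono (by lia)
      · exact hcb w (List.mem_append_left _ hw)
    · exact Set.subset_union_left
    · change p.bound < c
      lia
    · exact fun w hw => ⟨hw.1.mono (by change _ ≤ c; lia), hc w (.inl hw)⟩
    · exact fun w hw => .inr ⟨w, hw, rfl⟩
    · exact fun w hw => ⟨hcb w (List.mem_append_right _ hw), hc _ (.inr ⟨w, hw, rfl⟩)⟩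
  · refine ⟨⟨p.rel, p.bound + 1, p.enumRed, fun w hw => (p.lettersBelow w hw).mono (by lia)⟩,
      ⟨subset_rfl, Nat.lt_succ_self _, fun w hw => ⟨hw.1.mono (Nat.le_succ _), hw.2⟩⟩,
      b, hb1, hb2, fun h => (hc h).elim⟩

/-- The new relators present the free product with `F`, on a block of `k` new letters. Both factors
survive because each is a retract: kill the letters of the other one. -/
theorem exists_extends_group (p : EnumStage X) {k : ℕ} (Y : Set (List (Fin k × Bool)))
    (hY : EnumRed Y X) {F : Type*} [Group F] (f : Fin k → F) (hf : Y = {w | evalWord f w = 1}) :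
    ∃ q : EnumStage X, p.Extends q ∧ ∃ b, (∀ w ∈ Y, relabelWord (fun i => b + i.val) w ∈ q.rel) ∧
      ∀ w, w ∉ Y → relabelWord (fun i => b + i.val) w ∈ q.nonrel := by
  have hlet : ∀ w : List (Fin k × Bool),
      LettersBelow (p.bound + k + 1) (relabelWord (fun i => p.bound + i.val) w) := by
    intro w x hx
    obtain ⟨y, -, rfl⟩ := List.mem_map.1 hx
    simp only [Prod.map_fst]
    lia
  refine ⟨⟨p.rel ∪ relabelWord (fun i => p.bound + i.val) '' Y, p.bound + k + 1,
    p.enumRed.union (hY.image (primrec_relabelWord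
      (Primrec.nat_add.comp (.const _) Primrec.fin_val))), ?_⟩, ⟨?_, ?_, ?_⟩, p.bound, ?_, ?_⟩
  · rintro w (hw | ⟨w, hw, rfl⟩)
    · exact (p.lettersBelow w hw).mono (by lia)
    · exact hlet w
  · exact Set.subset_union_left
  · change p.bound < p.bound + k + 1
    lia
  · intro w hw
    refine ⟨hw.1.mono (by change p.bound ≤ p.bound + k + 1; lia), fun hm => hw.2 ?_⟩
    let x : ℕ → FreeGroup ℕ ⧸ relClosure p.rel := fun i => (FreeGroup.of i : FreeGroup ℕ)
    -- Retraction onto the old group, sending the new letters to `1`.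
    let γ : ℕ → FreeGroup ℕ ⧸ relClosure p.rel := fun i => if i < p.bound then x i else 1
    have hγ : ∀ w, LettersBelow p.bound w → evalWord γ w = (FreeGroup.mk w : FreeGroup ℕ) :=
      fun w hw => (evalWord_congr fun q hq => if_pos (hw q hq)).trans (evalWord_quotient _ w)
    have := evalWord_eq_one_of_mem_relClosure (α := γ) (by
      rintro r (hr | ⟨r, hr, rfl⟩)
      · rw [hγ r (p.lettersBelow r hr), QuotientGroup.eq_one_iff]
        exact mk_mem_relClosure hr
      · rw [evalWord_relabelWord]
        have : γ ∘ (fun i : Fin k => p.bound + i.val) = fun _ => 1 := by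
          ext i; simp [γ]
        rw [this]
        refine List.prod_eq_one fun a ha => ?_
        obtain ⟨⟨i, _ | _⟩, -, rfl⟩ := List.mem_map.1 ha <;> simp) hm
    rwa [hγ w hw.1, QuotientGroup.eq_one_iff] at this
  · exact fun w hw => .inr ⟨w, hw, rfl⟩
  · intro w hw
    refine ⟨hlet w, fun hm => hw ?_⟩
    -- Retraction onto `F`, sending all letters outside the new block to `1`.
    let γ : ℕ → F := fun i => if h : p.bound ≤ i ∧ i - p.bound < k then f ⟨i - p.bound, h.2⟩ else 1
    have hγ : ∀ w, evalWord γ (relabelWord (fun i : Fin k => p.bound + i.val) w) =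
        evalWord f w := by
      intro w
      rw [evalWord_relabelWord]
      congr 1
      ext i
      simp [γ]
    have := evalWord_eq_one_of_mem_relClosure (α := γ) (by
      rintro r (hr | ⟨r, hr, rfl⟩)
      · rw [evalWord_congr (β := fun _ => 1) fun q hq => ?_]
        · refine List.prod_eq_one fun a ha => ?_
          obtain ⟨⟨i, _ | _⟩, -, rfl⟩ := List.mem_map.1 ha <;> simp
        · have := p.lettersBelow r hr q hq
          simp only [γ]
          rw [dif_neg (by lia)]
      · rw [hγ]
        rwa [hf] at hr) hm
    rw [hγ] at this
    rwa [hf]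

end EnumStage

/-- There is a countable existentially closed group whose finitely generated subgroups are the
groups with word problem enumeration reducible to `X`. -/
theorem exists_existentiallyClosed_enumReducible (X : Set ℕ) :
    ∃ (M : Type) (_ : Group M), Countable M ∧ IsExistentiallyClosedGroup M ∧
      ∀ (F : Type) [Group F] (k : ℕ) (f : Fin k → F),
        Subgroup.closure (Set.range f) = ⊤ →
          ((∃ i : F →* M, Function.Injective i) ↔ EnumReducible (wordProblem f) X) := by
  -- There are countably many tasks, and each needs to be handled only once.
  let Task := (List SysWord × List SysWord) ⊕
    (Σ k : ℕ, {Y : Set (List (Fin k × Bool)) // EnumRed Y X})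
  have : ∀ k, Countable {Y : Set (List (Fin k × Bool)) // EnumRed Y X} := fun k =>
    (EnumRed.countable_setOf (List (Fin k × Bool)) X).to_subtype
  have : Nonempty Task := ⟨.inl ([], [])⟩
  obtain ⟨task, htask⟩ := exists_surjective_nat Task
  let Handles : EnumStage X → Task → EnumStage X → Prop := fun p t q =>
    match t with
    | .inl (A, B) => ∃ b, (∀ w ∈ p.rel ∪ p.nonrel, LettersBelow b w) ∧
      (∀ w ∈ A ++ B, ∀ p ∈ w, ∀ i, p.1 = Sum.inl i → i < b) ∧
      (ConsistentRel (p.rel ∪ {v | ∃ w ∈ A, instWord b w = v})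
        (p.nonrel ∪ {v | ∃ w ∈ B, instWord b w = v}) →
        (∀ w ∈ A, instWord b w ∈ q.rel) ∧ ∀ w ∈ B, instWord b w ∈ q.nonrel)
    | .inr ⟨k, Y⟩ => ∀ (F : Type) [Group F] (f : Fin k → F), Y.1 = {w | evalWord f w = 1} →
      ∃ b, (∀ w ∈ Y.1, relabelWord (fun i => b + i.val) w ∈ q.rel) ∧
        ∀ w, w ∉ Y.1 → relabelWord (fun i => b + i.val) w ∈ q.nonrel
  have hex : ∀ (p : EnumStage X) (t : Task), ∃ q, p.Extends q ∧ Handles p t q := by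
    rintro p (⟨A, B⟩ | ⟨k, Y, hY⟩)
    · exact p.exists_extends_system A B
    · by_cases h : ∃ (F : Type) (_ : Group F) (f : Fin k → F), Y = {w | evalWord f w = 1}
      · obtain ⟨F, _, f, hf⟩ := h
        obtain ⟨q, h1, h2⟩ := p.exists_extends_group Y hY f hf
        exact ⟨q, h1, fun _ _ _ _ => h2⟩
      -- If `Y` is not the word problem of any group, nothing is demanded and any extension will do.
      · obtain ⟨q, hq, -⟩ := p.exists_extends_system [] []
        exact ⟨q, hq, fun F _ f hf => (h ⟨F, _, f, hf⟩).elim⟩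
  choose next hnext hhandles using hex
  let st : ℕ → EnumStage X := fun s => s.rec
    ⟨∅, 0, by simpa using EnumRed.finite_list (α := Word) (X := X) [], by simp⟩
    fun s p => next p (task s)
  have hst : ∀ s, (st s).Extends (st (s + 1)) := fun s => hnext (st s) (task s)
  have hhst : ∀ s, Handles (st s) (task s) (st (s + 1)) := fun s => hhandles (st s) (task s)
  have hE : Monotone fun s => (st s).rel := monotone_nat_of_le_succ fun s => (hst s).rel_subset
  have hI : Monotone fun s => (st s).nonrel :=
    monotone_nat_of_le_succ fun s => (hst s).nonrel_subset
  -- The bounds tend to infinity, so every word is frozen from some stage on.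
  have hb : ∀ s, s ≤ (st s).bound := fun s => by
    induction s with
    | zero => exact Nat.zero_le _
    | succ s ih => exact ih.trans_lt (hst s).bound_lt
  have hcons := consistentRel_iUnion hE hI fun s => (st s).consistentRel
  refine ⟨FreeGroup ℕ ⧸ relClosure (⋃ s, (st s).rel), inferInstance, ?_, ?_, ?_⟩
  · exact Quotient.countable
  · refine isExistentiallyClosedGroup_of_stages hE hI (fun s => (st s).consistentRel) fun A B => ?_
    obtain ⟨s, hs⟩ := htask (.inl (A, B))
    have := hhst s
    rw [hs] at this
    exact ⟨s, this⟩
  · intro F _ k f hf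
    rw [enumReducible_wordProblem_iff]
    constructor
    · rintro ⟨i, hi⟩
      have hu : ∀ j, ∃ u : Word, ((FreeGroup.mk u : FreeGroup ℕ) :
          FreeGroup ℕ ⧸ relClosure (⋃ s, (st s).rel)) = i (f j) := by
        intro j
        induction i (f j) using QuotientGroup.induction_on with
        | H z => exact ⟨z.toWord, by rw [FreeGroup.mk_toWord]⟩
      choose u hu using hu
      -- A stage whose bound lies above all letters of the words representing the generators.
      obtain ⟨s, hs⟩ : ∃ s, s = encode (List.ofFn u) := ⟨_, rfl⟩
      have hsb : ∀ w, LettersBelow (st s).bound (substWord u w) := by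
        intro w p hp
        obtain ⟨⟨j, ε⟩, -, hq⟩ := List.mem_flatMap.1 hp
        have hj : LettersBelow (st s).bound (u j) :=
          (lettersBelow_encode (List.mem_ofFn.2 ⟨j, rfl⟩)).mono (hs ▸ hb s)
        cases ε
        · obtain ⟨x, hx, rfl⟩ := List.mem_map.1 (List.mem_reverse.1 hq)
          exact hj x hx
        · exact hj p hq
      -- For words below the bound of stage `s`, triviality in the limit is triviality at stage `s`:
      -- whatever does not follow then is protected forever.
      have key : {w | evalWord f w = 1} =
          substWord u ⁻¹' {v | FreeGroup.mk v ∈ relClosure (st s).rel} := by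
        ext w
        rw [Set.mem_ofPred_eq, ← map_eq_one_iff i hi, map_evalWord]
        have : i ∘ f = fun j => evalWord (fun i => ((FreeGroup.of i : FreeGroup ℕ) :
            FreeGroup ℕ ⧸ relClosure (⋃ s, (st s).rel))) (u j) := by
          ext j
          rw [evalWord_quotient, hu]
          rfl
        rw [this, ← evalWord_substWord, evalWord_quotient, QuotientGroup.eq_one_iff]
        constructor
        · intro h
          by_contra hn
          exact hcons _ (Set.mem_iUnion.2 ⟨s, hsb w, hn⟩) h
        · intro h
          exact relClosure_mono (Set.subset_iUnion (fun s => (st s).rel) s) h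
      rw [key]
      exact (st s).enumRed.mk_mem_relClosure.preimage (primrec_substWord u)
    · intro h
      obtain ⟨s, hs⟩ := htask (.inr ⟨k, _, h⟩)
      have := hhst s
      rw [hs] at this
      obtain ⟨b, h1, h2⟩ := this F f rfl
      refine exists_injective_hom_of_evalWord_iff hf
        (fun i : Fin k => ((FreeGroup.of (b + i.val) : FreeGroup ℕ) :
            FreeGroup ℕ ⧸ relClosure (⋃ s, (st s).rel))) fun w => ?_
      have : evalWord (fun i : Fin k => ((FreeGroup.of (b + i.val) : FreeGroup ℕ) :
            FreeGroup ℕ ⧸ relClosure (⋃ s, (st s).rel))) w = 1 ↔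
          FreeGroup.mk (relabelWord (fun i : Fin k => b + i.val) w) ∈
            relClosure (⋃ s, (st s).rel) := by
        rw [← QuotientGroup.eq_one_iff, ← evalWord_quotient, evalWord_relabelWord]
        rfl
      rw [this]
      constructor
      · exact fun hw => mk_mem_relClosure (Set.mem_iUnion.2 ⟨s + 1, h1 w hw⟩)
      · intro hm
        by_contra hn
        exact hcons _ (Set.mem_iUnion.2 ⟨s + 1, h2 w hn⟩) hm

/-! ### Computations with an oracle -/

open Classical in
/-- The characteristic function of a set of natural numbers. -/
noncomputable def charNat (X : Set ℕ) (n : ℕ) : ℕ := if n ∈ X then 1 else 0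

theorem charNat_of_mem {X : Set ℕ} {n : ℕ} (h : n ∈ X) : charNat X n = 1 := if_pos h

theorem charNat_of_notMem {X : Set ℕ} {n : ℕ} (h : n ∉ X) : charNat X n = 0 := if_neg h

/-- A total function which is computable with the oracle `X`. -/
def RecIn (X : Set ℕ) (f : ℕ → ℕ) : Prop :=
  Nat.RecursiveIn {charOracle X} fun n => Part.some (f n)

namespace RecIn

variable {X : Set ℕ} {f g : ℕ → ℕ}

theorem oracle : RecIn X (charNat X) := Nat.RecursiveIn.oracle _ rfl

theorem of_primrec (hf : Primrec f) : RecIn X f := (Primrec.nat_iff.1 hf).recursiveIn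

theorem comp (hf : RecIn X f) (hg : RecIn X g) : RecIn X fun n => f (g n) :=
  (Nat.RecursiveIn.comp hf hg).of_eq fun _ => Part.bind_some _ _

theorem pair (hf : RecIn X f) (hg : RecIn X g) : RecIn X fun n => Nat.pair (f n) (g n) :=
  (Nat.RecursiveIn.pair hf hg).of_eq fun n => by simp [Seq.seq]

theorem iterate (hf : RecIn X f) (a : ℕ) : RecIn X fun n => f^[n] a := by
  have h1 : RecIn X fun m => f (Nat.unpair (Nat.unpair m).2).2 :=
    hf.comp (of_primrec (.comp .snd (Primrec.unpair.comp (.comp .snd Primrec.unpair))))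
  have h2 := Nat.RecursiveIn.prec (of_primrec (X := X) (Primrec.const a)) h1
  refine (Nat.RecursiveIn.comp h2 ((of_primrec (Primrec.const 0)).pair
    (of_primrec Primrec.id))).of_eq fun n => ?_
  refine (Part.bind_some _ _).trans ?_
  simp only [Nat.unpair_pair, id]
  induction n with
  | zero => rfl
  | succ n ih =>
    simp only at ih ⊢
    rw [ih, Function.iterate_succ_apply']
    exact Part.bind_some _ _

theorem setTuringReducible {Y : Set ℕ} (h : RecIn X (charNat Y)) : SetTuringReducible Y X :=
  RecursiveIn.iff_nat.2 h

theorem of_setTuringReducible {Y : Set ℕ} (h : SetTuringReducible Y X) (hf : RecIn Y f) :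
    RecIn X f := by
  refine Nat.RecursiveIn.subst hf fun g hg => ?_
  obtain rfl := Set.mem_singleton_iff.1 hg
  exact RecursiveIn.iff_nat.1 h

/-- The sequence of states of a process which at each step asks one question to the oracle. -/
theorem process {α : Type*} [Primcodable α] {st : ℕ → α} {q : α → ℕ} {h : α → ℕ → α}
    (hq : Primrec q) (hh : Primrec₂ h) (hst : ∀ n, st (n + 1) = h (st n) (charNat X (q (st n))))
    {m : ℕ → ℕ} (hm : Primrec m) {out : ℕ → α → ℕ} (hout : Primrec₂ out) :
    RecIn X fun n => out n (st (m n)) := by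
  let dec : ℕ → α := fun e => (decode e : Option α).getD (st 0)
  have hdec : Primrec dec := Primrec.option_getD.comp Primrec.decode (.const _)
  have hde : ∀ a, dec (encode a) = a := fun a => by simp [dec]
  have h1 : RecIn X fun e => encode (h (dec e) (charNat X (q (dec e)))) := by
    have h2 : RecIn X fun e => Nat.pair e (charNat X (q (dec e))) :=
      (of_primrec Primrec.id).pair (oracle.comp (of_primrec (hq.comp hdec)))
    have h3 : Primrec fun p : ℕ => encode (h (dec p.unpair.1) p.unpair.2) :=
      Primrec.encode.comp (hh.comp (hdec.comp (.comp .fst .unpair)) (.comp .snd .unpair))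
    simpa using (of_primrec h3).comp h2
  have h4 : ∀ n, (fun e => encode (h (dec e) (charNat X (q (dec e)))))^[n] (encode (st 0)) =
      encode (st n) := by
    intro n
    induction n with
    | zero => rfl
    | succ n ih => rw [Function.iterate_succ_apply', ih, hde, ← hst]
  have h5 : RecIn X fun n => Nat.pair n (encode (st (m n))) := by
    refine (of_primrec Primrec.id).pair (comp (f := fun n => encode (st n)) ?_ (of_primrec hm))
    simpa only [h4] using h1.iterate (encode (st 0))
  have h6 : Primrec fun p : ℕ => out p.unpair.1 (dec p.unpair.2) :=
    hout.comp (.comp .fst .unpair) (hdec.comp (.comp .snd .unpair))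
  simpa [hde] using (of_primrec h6).comp h5

end RecIn

theorem setTuringReducible_of_primrec {Y Z : Set ℕ} {r : ℕ → ℕ} (hr : Primrec r)
    (h : ∀ n, n ∈ Y ↔ r n ∈ Z) : SetTuringReducible Y Z := by
  refine RecIn.setTuringReducible ?_
  have : charNat Y = fun n => charNat Z (r n) := by
    ext n
    by_cases hn : n ∈ Y
    · rw [charNat_of_mem hn, charNat_of_mem ((h n).1 hn)]
    · rw [charNat_of_notMem hn, charNat_of_notMem fun hr => hn ((h n).2 hr)]
  rw [this]
  exact RecIn.oracle.comp (.of_primrec hr)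

/-! ### Programs for the Turing jump -/

namespace OracleCode

theorem exists_eval_eq {g f : ℕ →. ℕ} (h : Nat.RecursiveIn {g} f) :
    ∃ c : OracleCode, c.eval g = f := by
  induction h with
  | zero => exact ⟨zero, rfl⟩
  | succ => exact ⟨succ, rfl⟩
  | left => exact ⟨left, rfl⟩
  | right => exact ⟨right, rfl⟩
  | oracle g' hg => exact ⟨oracle, (Set.mem_singleton_iff.1 hg).symm⟩
  | pair _ _ ih₁ ih₂ =>
    obtain ⟨c, rfl⟩ := ih₁
    obtain ⟨d, rfl⟩ := ih₂
    exact ⟨pair c d, rfl⟩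
  | comp _ _ ih₁ ih₂ =>
    obtain ⟨c, rfl⟩ := ih₁
    obtain ⟨d, rfl⟩ := ih₂
    exact ⟨comp c d, rfl⟩
  | prec _ _ ih₁ ih₂ =>
    obtain ⟨c, rfl⟩ := ih₁
    obtain ⟨d, rfl⟩ := ih₂
    exact ⟨prec c d, rfl⟩
  | rfind _ ih =>
    obtain ⟨c, rfl⟩ := ih
    exact ⟨rfind c, rfl⟩

/-- Basic instructions have numbers below 5, and the compound ones are larger and separated by their
residue modulo 4. Hence a program in the jump is determined by its number. -/
theorem number_injective : Function.Injective number := by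
  intro c
  induction c with
  | zero | succ | left | right | oracle => intro d h; cases d <;> simp only [number] at h ⊢ <;> lia
  | pair a b iha ihb | comp a b iha ihb | prec a b iha ihb =>
    intro d h
    cases d <;> simp only [number] at h <;> try lia
    rename_i a' b'
    have h1 : Nat.pair a.number b.number = Nat.pair a'.number b'.number := by lia
    rw [Nat.pair_eq_pair] at h1
    rw [iha h1.1, ihb h1.2]
  | rfind a iha =>
    intro d h
    cases d <;> simp only [number] at h <;> try lia
    rename_i a'
    rw [iha (show a.number = a'.number by lia)]

/-- The program for a constant function. -/
def const : ℕ → OracleCode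
  | 0 => zero
  | e + 1 => comp succ (const e)

theorem eval_const (g : ℕ →. ℕ) (e n : ℕ) : (const e).eval g n = Part.some e := by
  induction e with
  | zero => rfl
  | succ e ih =>
    have h : (const (e + 1)).eval g n = (const e).eval g n >>= succ.eval g := rfl
    rw [h, ih]
    exact Part.bind_some _ _

theorem primrec_number_const : Primrec fun e => (const e).number := by
  refine (Primrec.nat_rec₁ (f := fun _ m => 4 * Nat.pair 1 m + 6) 0
    (Primrec.nat_add.comp (Primrec.nat_mul.comp (.const 4)
      (Primrec₂.natPair.comp (.const 1) .snd)) (.const 6)).to₂).of_eq fun e => ?_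
  induction e with
  | zero => rfl
  | succ e ih =>
    rw [const, number, ← ih]
    rfl

end OracleCode

/-- The number `2 * n + 1` says that `n ∈ X`, and `2 * n` says that `n ∉ X`. -/
def literals (X : Set ℕ) : Set ℕ := {m | charNat X (m / 2) = m % 2}

theorem two_mul_add_one_mem_literals {X : Set ℕ} {n : ℕ} : 2 * n + 1 ∈ literals X ↔ n ∈ X := by
  change charNat X ((2 * n + 1) / 2) = (2 * n + 1) % 2 ↔ _
  rw [show (2 * n + 1) / 2 = n by lia, show (2 * n + 1) % 2 = 1 by lia, charNat]
  split_ifs with h <;> simp [h]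

theorem two_mul_mem_literals {X : Set ℕ} {n : ℕ} : 2 * n ∈ literals X ↔ n ∉ X := by
  change charNat X ((2 * n) / 2) = (2 * n) % 2 ↔ _
  rw [show (2 * n) / 2 = n by lia, show (2 * n) % 2 = 0 by lia, charNat]
  split_ifs with h <;> simp [h]

/-- The initial segment of length `n` of the characteristic function of `X`. -/
noncomputable def initialSegment (X : Set ℕ) (n : ℕ) : List ℕ := (List.range n).map (charNat X)

theorem initialSegment_succ (X : Set ℕ) (n : ℕ) :
    initialSegment X (n + 1) = initialSegment X n ++ [charNat X (initialSegment X n).length] := by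
  simp [initialSegment, List.range_succ]

theorem initialSegment_getElem?_eq_some {X : Set ℕ} {n i v : ℕ} :
    (initialSegment X n)[i]? = some v ↔ i < n ∧ charNat X i = v := by
  simp only [initialSegment, List.getElem?_map, Option.map_eq_some_iff, List.getElem?_eq_some_iff]
  simp

/-- Sets that are enumerable with the oracle `X` are many-one reducible to the jump of `X`. -/
theorem setTuringReducible_turingJump {S X : Set ℕ} (h : EnumRed S (literals X)) :
    SetTuringReducible S (turingJump X) := by
  obtain ⟨f, hf, hS⟩ := h
  -- With `n` coding `e` and `j`, the value is `0` iff the axiom numbered by the first component of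
  -- `j` is for `e` and its literals are confirmed by `σ`. The number `j` is also the length of the
  -- initial segment used.
  let out : ℕ → List ℕ → ℕ := fun n σ => ((f n.unpair.2.unpair.1).bind fun p =>
    if p.1 = n.unpair.1 ∧ ∀ m ∈ p.2, σ[m / 2]? = some (m % 2) then some 0 else none).getD 1
  have hout : Primrec₂ out := by
    have hrel : PrimrecRel fun (m : ℕ) (σ : List ℕ) => σ[m / 2]? = some (m % 2) :=
      Primrec.eq.comp (Primrec.list_getElem?.comp .snd (Primrec.nat_div.comp .fst (.const 2)))
        (Primrec.option_some.comp (Primrec.nat_mod.comp .fst (.const 2)))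
    have hpred : PrimrecPred fun a : (ℕ × List ℕ) × ℕ × List ℕ =>
        a.2.1 = a.1.1.unpair.1 ∧ ∀ m ∈ a.2.2, a.1.2[m / 2]? = some (m % 2) :=
      .and (Primrec.eq.comp (.comp .fst .snd)
        (.comp .fst (Primrec.unpair.comp (.comp .fst .fst))))
        (hrel.forall_mem_list.comp (.comp .snd .snd) (.comp .snd .fst))
    exact Primrec.option_getD.comp (Primrec.option_bind (hf.comp (.comp .fst (Primrec.unpair.comp
      (.comp .snd (Primrec.unpair.comp .fst)))))
      (Primrec.ite hpred (.const _) (.const _)).to₂) (.const 1)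
  have htest : RecIn X fun n => out n (initialSegment X n.unpair.2) :=
    RecIn.process (st := initialSegment X) (q := List.length) (h := fun σ v => σ ++ [v])
      Primrec.list_length Primrec.list_concat (initialSegment_succ X)
      (.comp .snd .unpair) hout
  obtain ⟨c, hc⟩ := OracleCode.exists_eval_eq htest
  have hmem : ∀ e, e ∈ S ↔ ∃ j, out (Nat.pair e j) (initialSegment X j) = 0 := by
    intro e
    have hz : ∀ j, out (Nat.pair e j) (initialSegment X j) = 0 ↔ ∃ D, f j.unpair.1 = some (e, D) ∧
        ∀ m ∈ D, (initialSegment X j)[m / 2]? = some (m % 2) := by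
      intro j
      simp only [out, Nat.unpair_pair]
      rcases f j.unpair.1 with _ | ⟨a, D⟩
      · simp
      · simp only [Option.bind_some, Option.some.injEq, Prod.mk.injEq]
        split_ifs with h
        · simpa [h.1] using h.2
        · simp only [Option.getD_none, one_ne_zero, false_iff]
          rintro ⟨D', ⟨rfl, rfl⟩, h'⟩
          exact h ⟨rfl, h'⟩
    simp only [hz, hS, initialSegment_getElem?_eq_some]
    constructor
    · rintro ⟨k, D, h1, h2⟩
      -- Pairing with the code of `D` makes the segment long enough to answer every literal in `D`.
      refine ⟨Nat.pair k (encode D), D, by simpa using h1, fun m hm => ⟨?_, h2 m hm⟩⟩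
      have := encode_lt_encode_of_mem hm
      have h3 := Nat.right_le_pair k (encode D)
      rw [encode_nat] at this
      lia
    · rintro ⟨j, D, h1, h2⟩
      exact ⟨_, D, h1, fun m hm => (h2 m hm).2⟩
  -- The program ignores its input and searches for a confirmed axiom for `e`, so it halts on its
  -- own number iff `e ∈ S`.
  refine setTuringReducible_of_primrec (r := fun e =>
    ((c.rfind).comp (OracleCode.const e)).number) ?_ fun e => ?_
  · exact Primrec.nat_add.comp (Primrec.nat_mul.comp (.const 4)
      (Primrec₂.natPair.comp (.const _) OracleCode.primrec_number_const)) (.const 6)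
  · have hdom : ∀ n, (((c.rfind).comp (OracleCode.const e)).eval (charOracle X) n).Dom ↔ e ∈ S := by
      intro n
      have h1 : ((c.rfind).comp (OracleCode.const e)).eval (charOracle X) n =
          Nat.rfind fun j => Part.some (decide (out (Nat.pair e j) (initialSegment X j) = 0)) := by
        have h2 : ((c.rfind).comp (OracleCode.const e)).eval (charOracle X) n =
          (OracleCode.const e).eval (charOracle X) n >>= c.rfind.eval (charOracle X) := rfl
        rw [h2, OracleCode.eval_const]
        refine (Part.bind_some _ _).trans ?_
        rw [OracleCode.eval, hc]
        simp
      rw [h1, hmem]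
      refine Nat.rfind_dom.trans ⟨?_, ?_⟩
      · rintro ⟨k, hk, -⟩
        exact ⟨k, of_decide_eq_true (Part.mem_some_iff.1 hk).symm⟩
      · rintro ⟨k, hk⟩
        exact ⟨k, Part.mem_some_iff.2 (decide_eq_true hk).symm, fun _ => trivial⟩
    rw [← hdom]
    constructor
    · exact fun h => ⟨_, rfl, h⟩
    · rintro ⟨d, hd, h⟩
      rwa [OracleCode.number_injective hd] at h

/-! ### Tables -/

section Table

variable {σ : Type*}

/-- The table of the values of a function defined by course-of-values recursion. -/
def table (step : List σ → σ) : ℕ → List σ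
  | 0 => []
  | k + 1 => table step k ++ [step (table step k)]

theorem length_table (step : List σ → σ) (k : ℕ) : (table step k).length = k := by
  induction k with
  | zero => rfl
  | succ k ih => simp [table, ih]

theorem table_getElem? (step : List σ → σ) {i k : ℕ} (h : i < k) :
    (table step k)[i]? = some (step (table step i)) := by
  induction k with
  | zero => lia
  | succ k ih =>
    rw [table]
    rcases Nat.lt_succ_iff_lt_or_eq.1 h with h | rfl
    · rw [List.getElem?_append_left (by rwa [length_table]), ih h]
    · rw [List.getElem?_append_right (by rw [length_table]), length_table]
      simp

theorem primrec_table [Primcodable σ] {step : List σ → σ} (h : Primrec step) :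
    Primrec (table step) := by
  refine (Primrec.nat_rec₁ (f := fun _ T => T ++ [step T]) []
    (Primrec.list_concat.comp .snd (h.comp .snd)).to₂).of_eq fun k => ?_
  induction k with
  | zero => rfl
  | succ k ih => rw [table, ← ih]

end Table

/-- Compound expressions have positive tags, so their parts have smaller Gödel numbers and are found
in the table. -/
theorem Nat.right_lt_pair_of_pos {a : ℕ} (ha : 0 < a) (b : ℕ) : b < Nat.pair a b := by
  unfold Nat.pair
  split_ifs <;> nlinarith

/-! ### Terms and quantifier-free sentences -/

/-- The word with a given code. -/
def wordOfNat (i : ℕ) : Word := (decode i : Option Word).getD []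

theorem primrec_wordOfNat : Primrec wordOfNat :=
  Primrec.option_getD.comp Primrec.decode (.const _)

theorem wordOfNat_encode (w : Word) : wordOfNat (encode w) = w := by simp [wordOfNat]

/-- The recursion step for `termWord`. -/
def termStep (T : List (Option Word)) : Option Word :=
  if T.length.unpair.1 = 0 then some (wordOfNat T.length.unpair.2)
  else if T.length = Nat.pair 2 0 then some []
  else if T.length.unpair.1 = 3 then (T[T.length.unpair.2]?.getD none).map FreeGroup.invRev
  else if T.length.unpair.1 = 4 then (T[T.length.unpair.2.unpair.1]?.getD none).bind fun u =>
    (T[T.length.unpair.2.unpair.2]?.getD none).map fun v => u ++ v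
  else none

/-- The word that corresponds to the closed term with a given Gödel number, if the number `i`
denotes the constant for the value of the `i`-th word. -/
def termWord (k : ℕ) : Option Word := termStep (table termStep k)

theorem primrec_termWord : Primrec termWord := by
  have hlen : Primrec fun T : List (Option Word) => T.length.unpair :=
    Primrec.unpair.comp Primrec.list_length
  have hget : ∀ {i : List (Option Word) → ℕ}, Primrec i → Primrec fun T => T[i T]?.getD none :=
    fun hi => Primrec.option_getD.comp (Primrec.list_getElem?.comp .id hi) (.const none)
  have hstep : Primrec termStep := by
    refine Primrec.ite (Primrec.eq.comp (.comp .fst hlen) (.const 0))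
      (Primrec.option_some.comp (primrec_wordOfNat.comp (.comp .snd hlen))) ?_
    refine Primrec.ite (Primrec.eq.comp .list_length (.const _)) (.const _) ?_
    refine Primrec.ite (Primrec.eq.comp (.comp .fst hlen) (.const 3))
      (Primrec.option_map (hget (.comp .snd hlen)) (primrec_invRev.comp .snd).to₂) ?_
    refine Primrec.ite (Primrec.eq.comp (.comp .fst hlen) (.const 4)) ?_ (.const none)
    exact Primrec.option_bind (hget (.comp .fst (Primrec.unpair.comp (.comp .snd hlen))))
      (Primrec.option_map ((hget (.comp .snd (Primrec.unpair.comp (.comp .snd hlen)))).comp .fst)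
        (Primrec.list_append.comp (.comp .snd .fst) .snd).to₂).to₂
  exact hstep.comp (primrec_table hstep)

theorem termWord_pair_zero (i : ℕ) : termWord (Nat.pair 0 i) = some (wordOfNat i) := by
  simp [termWord, termStep, length_table]

theorem termWord_pair_one (i : ℕ) : termWord (Nat.pair 1 i) = none := by
  simp [termWord, termStep, length_table, Nat.pair_eq_pair]

theorem termWord_pair_two (i : ℕ) :
    termWord (Nat.pair 2 i) = if i = 0 then some [] else none := by
  simp [termWord, termStep, length_table, Nat.pair_eq_pair]

theorem termWord_pair_three (i : ℕ) :
    termWord (Nat.pair 3 i) = (termWord i).map FreeGroup.invRev := by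
  rw [termWord, termStep]
  simp [length_table, Nat.pair_eq_pair,
    table_getElem? termStep (Nat.right_lt_pair_of_pos (a := 3) (by simp) i), termWord]

theorem termWord_pair_four (i j : ℕ) : termWord (Nat.pair 4 (Nat.pair i j)) =
    (termWord i).bind fun u => (termWord j).map fun v => u ++ v := by
  have h := Nat.right_lt_pair_of_pos (a := 4) (by simp) (Nat.pair i j)
  rw [termWord, termStep]
  simp [length_table, Nat.pair_eq_pair,
    table_getElem? termStep ((Nat.left_le_pair i j).trans_lt h),
    table_getElem? termStep ((Nat.right_le_pair i j).trans_lt h), termWord]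

theorem termWord_pair_of_gt {a : ℕ} (h : 4 < a) (i : ℕ) : termWord (Nat.pair a i) = none := by
  rw [termWord, termStep]
  simp only [length_table, Nat.unpair_pair, Nat.pair_eq_pair]
  rw [if_neg (by lia), if_neg (by lia), if_neg (by lia), if_neg (by lia)]

section Sentences

open FirstOrder Language

/-- Numbers that are not codes of closed terms must be recognised, since they may not contribute to
the diagram. -/
theorem exists_groupTermNumber_eq {k : ℕ} {w : Word} (h : termWord k = some w) :
    ∃ t : groupLanguage.Term (ℕ ⊕ Fin 0), groupTermNumber t = k := by
  induction k using Nat.strong_induction_on generalizing w with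
  | _ k ih =>
  obtain ⟨a, i, rfl⟩ : ∃ a i, k = Nat.pair a i := ⟨_, _, (Nat.pair_unpair k).symm⟩
  rcases Nat.lt_or_ge 4 a with ha | ha
  · simp [termWord_pair_of_gt ha] at h
  interval_cases a
  · exact ⟨.var (.inl i), rfl⟩
  · simp [termWord_pair_one] at h
  · rw [termWord_pair_two] at h
    split_ifs at h with hi
    subst hi
    exact ⟨.func GroupFunc.one ![], rfl⟩
  · rw [termWord_pair_three] at h
    obtain ⟨u, hu, -⟩ := Option.map_eq_some_iff.1 h
    obtain ⟨t, ht⟩ := ih i (Nat.right_lt_pair_of_pos (by simp) i) hu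
    refine ⟨.func GroupFunc.inv ![t], ?_⟩
    rw [← ht]
    rfl
  · obtain ⟨i, j, rfl⟩ : ∃ a b, i = Nat.pair a b := ⟨_, _, (Nat.pair_unpair i).symm⟩
    have hlt := Nat.right_lt_pair_of_pos (a := 4) (by simp) (Nat.pair i j)
    rw [termWord_pair_four] at h
    obtain ⟨u, hu, h⟩ := Option.bind_eq_some_iff.1 h
    obtain ⟨v, hv, -⟩ := Option.map_eq_some_iff.1 h
    obtain ⟨s, hs⟩ := ih i ((Nat.left_le_pair i j).trans_lt hlt) hu
    obtain ⟨t, ht⟩ := ih j ((Nat.right_le_pair i j).trans_lt hlt) hv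
    refine ⟨.func GroupFunc.mul ![s, t], ?_⟩
    rw [← hs, ← ht]
    rfl

section Quotient

variable (N : Subgroup (FreeGroup ℕ))

/-- The enumeration of a quotient of the free group by the codes of words. -/
def quotientEnum (i : ℕ) : FreeGroup ℕ ⧸ N := (FreeGroup.mk (wordOfNat i) : FreeGroup ℕ)

theorem quotientEnum_surjective : Function.Surjective (quotientEnum N) := by
  intro m
  induction m using QuotientGroup.induction_on with
  | H z => exact ⟨encode z.toWord, by rw [quotientEnum, wordOfNat_encode, FreeGroup.mk_toWord]⟩

/-- The pairs of Gödel numbers of closed terms with the same value. -/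
def equalTerms : Set ℕ := {k | FreeGroup.mk ((termWord k.unpair.1).getD [] ++
  FreeGroup.invRev ((termWord k.unpair.2).getD [])) ∈ N}

/-- The recursion step for the evaluation of sentences: the value `0` means that the number is not
the Gödel number of a quantifier-free sentence, the values `1` and `2` are the truth values. -/
def sentenceStep (T : List ℕ) (v : ℕ) : ℕ :=
  if T.length = Nat.pair 0 0 then 1
  else if T.length.unpair.1 = 1 then
    if (termWord T.length.unpair.2.unpair.1).isSome = true ∧
      (termWord T.length.unpair.2.unpair.2).isSome = true then v + 1 else 0
  else if T.length.unpair.1 = 2 then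
    if T[T.length.unpair.2.unpair.1]?.getD 0 = 0 ∨ T[T.length.unpair.2.unpair.2]?.getD 0 = 0 then 0
    else if T[T.length.unpair.2.unpair.1]?.getD 0 = 2 ∧ T[T.length.unpair.2.unpair.2]?.getD 0 = 1
      then 1 else 2
  else 0

theorem primrec_sentenceStep : Primrec₂ sentenceStep := by
  have hlen : Primrec fun p : List ℕ × ℕ => p.1.length.unpair :=
    Primrec.unpair.comp (Primrec.list_length.comp .fst)
  have h2 : Primrec fun p : List ℕ × ℕ => p.1.length.unpair.2.unpair :=
    Primrec.unpair.comp (.comp .snd hlen)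
  have hl : Primrec fun p : List ℕ × ℕ => p.1[p.1.length.unpair.2.unpair.1]?.getD 0 :=
    Primrec.option_getD.comp (Primrec.list_getElem?.comp .fst (.comp .fst h2)) (.const 0)
  have hr : Primrec fun p : List ℕ × ℕ => p.1[p.1.length.unpair.2.unpair.2]?.getD 0 :=
    Primrec.option_getD.comp (Primrec.list_getElem?.comp .fst (.comp .snd h2)) (.const 0)
  refine Primrec.ite (Primrec.eq.comp (Primrec.list_length.comp .fst) (.const _)) (.const _) ?_
  refine Primrec.ite (Primrec.eq.comp (.comp .fst hlen) (.const _)) ?_ ?_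
  · refine Primrec.ite (.and (Primrec.eq.comp (Primrec.option_isSome.comp
      (primrec_termWord.comp (.comp .fst h2))) (.const true))
      (Primrec.eq.comp (Primrec.option_isSome.comp
      (primrec_termWord.comp (.comp .snd h2))) (.const true)))
      (Primrec.succ.comp .snd) (.const 0)
  · refine Primrec.ite (Primrec.eq.comp (.comp .fst hlen) (.const _)) ?_ (.const 0)
    refine Primrec.ite (.or (Primrec.eq.comp hl (.const 0)) (Primrec.eq.comp hr (.const 0)))
      (.const 0) (Primrec.ite (.and (Primrec.eq.comp hl (.const 2)) (Primrec.eq.comp hr (.const 1)))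
      (.const 1) (.const 2))

/-- The table of the values of sentences. -/
noncomputable def sentenceTable : ℕ → List ℕ :=
  table fun T => sentenceStep T (charNat (equalTerms N) T.length.unpair.2)

/-- The value of the sentence with a given Gödel number. -/
noncomputable def sentenceValue (k : ℕ) : ℕ :=
  sentenceStep (sentenceTable N k) (charNat (equalTerms N) k.unpair.2)

theorem sentenceTable_succ (k : ℕ) :
    sentenceTable N (k + 1) = sentenceTable N k ++ [sentenceValue N k] := by
  rw [sentenceTable, table, sentenceValue, sentenceTable, length_table]

theorem sentenceTable_getElem? {i k : ℕ} (h : i < k) :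
    (sentenceTable N k)[i]? = some (sentenceValue N i) := by
  rw [sentenceTable, table_getElem? _ h, sentenceValue, sentenceTable, length_table]

theorem sentenceValue_falsum : sentenceValue N (Nat.pair 0 0) = 1 := by
  rw [sentenceValue, sentenceStep, sentenceTable, length_table, if_pos rfl]

theorem sentenceValue_equal (i j : ℕ) : sentenceValue N (Nat.pair 1 (Nat.pair i j)) =
    if (termWord i).isSome = true ∧ (termWord j).isSome = true then
      charNat (equalTerms N) (Nat.pair i j) + 1 else 0 := by
  rw [sentenceValue, sentenceStep, sentenceTable, length_table, if_neg (by simp [Nat.pair_eq_pair]),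
    Nat.unpair_pair, if_pos rfl, Nat.unpair_pair]

theorem sentenceValue_imp (i j : ℕ) : sentenceValue N (Nat.pair 2 (Nat.pair i j)) =
    if sentenceValue N i = 0 ∨ sentenceValue N j = 0 then 0
    else if sentenceValue N i = 2 ∧ sentenceValue N j = 1 then 1 else 2 := by
  have h := Nat.right_lt_pair_of_pos (a := 2) (by simp) (Nat.pair i j)
  have hlen : (sentenceTable N (Nat.pair 2 (Nat.pair i j))).length = Nat.pair 2 (Nat.pair i j) :=
    length_table _ _
  rw [sentenceValue, sentenceStep, hlen, if_neg (by simp [Nat.pair_eq_pair]),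
    Nat.unpair_pair, if_neg (by simp), if_pos rfl, Nat.unpair_pair,
    sentenceTable_getElem? N ((Nat.left_le_pair i j).trans_lt h),
    sentenceTable_getElem? N ((Nat.right_le_pair i j).trans_lt h)]
  rfl

theorem sentenceValue_pair_eq_zero {a i : ℕ} (ha : 2 < a) : sentenceValue N (Nat.pair a i) = 0 := by
  rw [sentenceValue, sentenceStep, sentenceTable, length_table,
    if_neg (by rw [Nat.pair_eq_pair]; lia), Nat.unpair_pair, if_neg (by simp; lia),
    if_neg (by simp; lia)]

/-- Tags above 2, in particular that of the quantifier, evaluate to `0`; the formula recovered by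
recursion is therefore quantifier-free. -/
theorem exists_groupFormulaNumber_eq {k : ℕ} (h : sentenceValue N k ≠ 0) :
    ∃ φ : groupLanguage.BoundedFormula ℕ 0, φ.IsQF ∧ groupFormulaNumber φ = k := by
  induction k using Nat.strong_induction_on with
  | _ k ih =>
  obtain ⟨a, i, rfl⟩ : ∃ a i, k = Nat.pair a i := ⟨_, _, (Nat.pair_unpair k).symm⟩
  rcases Nat.lt_or_ge 2 a with ha | ha
  · exact (h (sentenceValue_pair_eq_zero N ha)).elim
  interval_cases a
  · rcases Nat.eq_zero_or_pos i with rfl | hi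
    · exact ⟨⊥, .falsum, rfl⟩
    · refine (h ?_).elim
      rw [sentenceValue, sentenceStep, sentenceTable, length_table,
        if_neg (by rw [Nat.pair_eq_pair]; lia), Nat.unpair_pair, if_neg (by simp),
        if_neg (by simp)]
  · obtain ⟨i, j, rfl⟩ : ∃ a b, i = Nat.pair a b := ⟨_, _, (Nat.pair_unpair i).symm⟩
    rw [sentenceValue_equal, ne_eq, ite_eq_right_iff, Classical.not_imp] at h
    obtain ⟨u, hu⟩ := Option.isSome_iff_exists.1 h.1.1
    obtain ⟨v, hv⟩ := Option.isSome_iff_exists.1 h.1.2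
    obtain ⟨s, rfl⟩ := exists_groupTermNumber_eq hu
    obtain ⟨t, rfl⟩ := exists_groupTermNumber_eq hv
    exact ⟨s.bdEqual t, .of_isAtomic (.equal s t), rfl⟩
  · obtain ⟨i, j, rfl⟩ : ∃ a b, i = Nat.pair a b := ⟨_, _, (Nat.pair_unpair i).symm⟩
    have hlt := Nat.right_lt_pair_of_pos (a := 2) (by simp) (Nat.pair i j)
    rw [sentenceValue_imp, ne_eq, ite_eq_left_iff, Classical.not_imp, not_or] at h
    obtain ⟨φ, hφ, rfl⟩ := ih i ((Nat.left_le_pair _ _).trans_lt hlt) h.1.1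
    obtain ⟨ψ, hψ, rfl⟩ := ih j ((Nat.right_le_pair _ _).trans_lt hlt) h.1.2
    exact ⟨φ.imp ψ, hφ.imp hψ, rfl⟩

variable [N.Normal]

theorem exists_termWord_eq (t : groupLanguage.Term (ℕ ⊕ Fin 0)) (xs : Fin 0 → FreeGroup ℕ ⧸ N) :
    ∃ w, termWord (groupTermNumber t) = some w ∧
      t.realize (Sum.elim (quotientEnum N) xs) = (FreeGroup.mk w : FreeGroup ℕ) := by
  induction t with
  | var x =>
    rcases x with i | j
    · exact ⟨wordOfNat i, termWord_pair_zero i, rfl⟩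
    · exact j.elim0
  | func f ts ih =>
    choose w hw hr using ih
    cases f with
    | one => exact ⟨[], by rw [groupTermNumber, termWord_pair_two, if_pos rfl], rfl⟩
    | inv =>
      refine ⟨FreeGroup.invRev (w 0), ?_, ?_⟩
      · rw [groupTermNumber, termWord_pair_three, hw]
        rfl
      · rw [← FreeGroup.inv_mk, QuotientGroup.mk_inv, ← hr]
        rfl
    | mul =>
      refine ⟨w 0 ++ w 1, ?_, ?_⟩
      · rw [groupTermNumber, termWord_pair_four, hw, hw]
        rfl
      · rw [← FreeGroup.mul_mk, QuotientGroup.mk_mul, ← hr, ← hr]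
        rfl

open Classical in
theorem sentenceValue_eq {φ : groupLanguage.BoundedFormula ℕ 0} (hφ : φ.IsQF)
    (xs : Fin 0 → FreeGroup ℕ ⧸ N) : sentenceValue N (groupFormulaNumber φ) =
      if φ.Realize (quotientEnum N) xs then 2 else 1 := by
  induction hφ with
  | falsum => exact (sentenceValue_falsum N).trans (if_neg fun h => h).symm
  | of_isAtomic h =>
    cases h with
    | equal s t =>
      obtain ⟨u, hu, hu'⟩ := exists_termWord_eq N s xs
      obtain ⟨v, hv, hv'⟩ := exists_termWord_eq N t xs
      have hmem : Nat.pair (groupTermNumber s) (groupTermNumber t) ∈ equalTerms N ↔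
          (s.bdEqual t).Realize (quotientEnum N) xs := by
        rw [BoundedFormula.realize_bdEqual, hu', hv', equalTerms]
        simp only [Set.mem_ofPred_eq, Nat.unpair_pair, hu, hv, Option.getD_some]
        rw [← QuotientGroup.eq_one_iff, ← FreeGroup.mul_mk, ← FreeGroup.inv_mk,
          QuotientGroup.mk_mul, QuotientGroup.mk_inv, mul_inv_eq_one]
      have h1 : sentenceValue N (groupFormulaNumber (s.bdEqual t)) =
          charNat (equalTerms N) (Nat.pair (groupTermNumber s) (groupTermNumber t)) + 1 := by
        refine (sentenceValue_equal N _ _).trans (if_pos ?_)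
        simp [hu, hv]
      rw [h1]
      split_ifs with h
      · rw [charNat_of_mem (hmem.2 h)]
      · rw [charNat_of_notMem fun h' => h (hmem.1 h')]
    | rel R ts => exact R.elim
  | @imp φ ψ _ _ ih₁ ih₂ =>
    have h1 : sentenceValue N (groupFormulaNumber (φ.imp ψ)) = _ := sentenceValue_imp N _ _
    rw [h1, ih₁, ih₂, BoundedFormula.realize_imp]
    by_cases h : φ.Realize (quotientEnum N) xs <;> by_cases h' : ψ.Realize (quotientEnum N) xs <;>
      simp [h, h']

theorem mem_qfDiagram_iff (k : ℕ) : k ∈ qfDiagram (quotientEnum N) ↔ sentenceValue N k = 2 := by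
  constructor
  · rintro ⟨φ, rfl, hφ, h⟩
    exact (sentenceValue_eq N hφ _).trans (if_pos h)
  · intro h
    obtain ⟨φ, hφ, rfl⟩ := exists_groupFormulaNumber_eq N (k := k) (by lia)
    refine ⟨φ, rfl, hφ, ?_⟩
    by_contra hn
    have := (sentenceValue_eq N hφ _).trans (if_neg hn)
    lia

/-- A quotient of the free group is computable from the set of codes of trivial words. -/
theorem computesGroup_quotient {X : Set ℕ}
    (h : SetTuringReducible {k | FreeGroup.mk (wordOfNat k) ∈ N} X) :
    ComputesGroup X (FreeGroup ℕ ⧸ N) := by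
  refine ⟨quotientEnum N, quotientEnum_surjective N, ?_⟩
  have h1 : SetTuringReducible (equalTerms N) {k | FreeGroup.mk (wordOfNat k) ∈ N} := by
    have hget : Primrec fun k => (termWord k).getD [] :=
      Primrec.option_getD.comp primrec_termWord (.const [])
    refine setTuringReducible_of_primrec (r := fun k => encode ((termWord k.unpair.1).getD [] ++
      FreeGroup.invRev ((termWord k.unpair.2).getD []))) (Primrec.encode.comp
      (Primrec.list_append.comp (hget.comp (.comp .fst .unpair))
        (primrec_invRev.comp (hget.comp (.comp .snd .unpair))))) fun k => ?_
    simp only [Set.mem_ofPred_eq, wordOfNat_encode]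
    rfl
  have h2 : RecIn (equalTerms N) (sentenceValue N) := by
    -- Each table entry asks one question about the second component of its number. The answer is
    -- used only for equations.
    have := RecIn.process (X := equalTerms N) (st := sentenceTable N)
      (q := fun T => T.length.unpair.2) (h := fun T v => T ++ [sentenceStep T v])
      (.comp .snd (Primrec.unpair.comp .list_length))
      (Primrec.list_concat.comp .fst primrec_sentenceStep) (fun n => by
        rw [sentenceTable_succ, sentenceValue, sentenceTable, length_table])
      -- Entry `n` first appears in the table of length `n + 1`.
      Primrec.succ (out := fun n T => T[n]?.getD 0)
      (Primrec.option_getD.comp (Primrec.list_getElem?.comp .snd .fst) (.const 0))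
    simpa [sentenceTable_getElem?] using this
  refine RecIn.setTuringReducible (.of_setTuringReducible h (.of_setTuringReducible h1 ?_))
  have h3 : charNat (qfDiagram (quotientEnum N)) =
      fun k => if sentenceValue N k = 2 then 1 else 0 := by
    ext k
    split_ifs with h
    · exact charNat_of_mem ((mem_qfDiagram_iff N k).2 h)
    · exact charNat_of_notMem fun h' => h ((mem_qfDiagram_iff N k).1 h')
  rw [h3]
  exact (RecIn.of_primrec (f := fun m => if m = 2 then 1 else 0) (Primrec.ite
    (Primrec.eq.comp .id (.const 2)) (.const 1) (.const 0))).comp h2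

end Quotient

end Sentences

/-! ### Greedy addition of systems with an oracle for inconsistency. -/

theorem primrec_instWord : Primrec₂ instWord := by
  have h : Primrec fun a : (ℕ × SysWord) × (ℕ ⊕ ℕ) × Bool => Sum.elim id (a.1.1 + ·) a.2.1 :=
    (Primrec.sumCasesOn (.comp .fst .snd) Primrec.snd.to₂
      (Primrec.nat_add.comp (.comp .fst (.comp .fst .fst)) .snd).to₂).of_eq
      fun a => by rcases a with ⟨_, i | i, _⟩ <;> rfl
  exact Primrec.list_map .snd (Primrec.pair h (.comp .snd .snd)).to₂

theorem instWord_relabelWord_inl (b : ℕ) (w : Word) : instWord b (relabelWord Sum.inl w) = w := by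
  rw [instWord, relabelWord, relabelWord, List.map_map]
  exact List.map_id w

section Greedy

/-- A finite system of equations and inequations. -/
abbrev WordSystem := List SysWord × List SysWord

/-- The system with a given code. -/
def systemOfNat (i : ℕ) : WordSystem := (decode i : Option WordSystem).getD ([], [])

/-- The words that have been put equal, respectively not equal, to the identity before a stage
which is the first component. -/
abbrev GreedyState := ℕ × List Word × List Word

variable (n : ℕ)

/-- The first of the fresh letters that are used at a stage. -/
def freshLetter (p : GreedyState) : ℕ :=
  n + encode (p.2.1 ++ p.2.2) + encode ((systemOfNat p.1).1 ++ (systemOfNat p.1).2)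

/-- Add the system which belongs to the stage, with fresh letters for the variables. -/
def addSystem (p : GreedyState) : List Word × List Word :=
  (p.2.1 ++ (systemOfNat p.1).1.map (instWord (freshLetter n p)),
    p.2.2 ++ (systemOfNat p.1).2.map (instWord (freshLetter n p)))

/-- The system of the stage is added unless the answer of the oracle is positive. -/
def greedyStep (p : GreedyState) (v : ℕ) : GreedyState :=
  (p.1 + 1, if v = 0 then addSystem n p else p.2)

theorem primrec_addSystem : Primrec (addSystem n) := by
  have hs : Primrec fun p : GreedyState => systemOfNat p.1 :=
    (Primrec.option_getD.comp Primrec.decode (.const _)).comp .fst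
  have hb : Primrec (freshLetter n) :=
    Primrec.nat_add.comp (Primrec.nat_add.comp (.const n) (Primrec.encode.comp
      (Primrec.list_append.comp (.comp .fst .snd) (.comp .snd .snd))))
      (Primrec.encode.comp (Primrec.list_append.comp (.comp .fst hs) (.comp .snd hs)))
  have hi : Primrec₂ fun (p : GreedyState) w => instWord (freshLetter n p) w :=
    primrec_instWord.comp (hb.comp .fst) .snd
  exact .pair (Primrec.list_append.comp (.comp .fst .snd) (.list_map (.comp .fst hs) hi))
    (Primrec.list_append.comp (.comp .snd .snd) (.list_map (.comp .snd hs) hi))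

theorem primrec_greedyStep : Primrec₂ (greedyStep n) :=
  Primrec.pair (Primrec.succ.comp (.comp .fst .fst)) (Primrec.ite (Primrec.eq.comp .snd (.const 0))
    ((primrec_addSystem n).comp .fst) (.comp .snd .fst))

variable (S : Set ℕ)

/-- The states of the greedy construction with an oracle for the inconsistent pairs. -/
noncomputable def greedyState : ℕ → GreedyState
  | 0 => (0, [], [])
  | s + 1 => greedyStep n (greedyState s) (charNat S (encode (addSystem n (greedyState s))))

theorem greedyState_fst (s : ℕ) : (greedyState n S s).1 = s := by
  induction s with
  | zero => rfl
  | succ s ih => rw [greedyState, greedyStep, ih]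

theorem greedyState_succ_of_notMem {s : ℕ} (h : encode (addSystem n (greedyState n S s)) ∉ S) :
    (greedyState n S (s + 1)).2 = addSystem n (greedyState n S s) := by
  rw [greedyState, greedyStep, charNat_of_notMem h, if_pos rfl]

theorem greedyState_succ_of_mem {s : ℕ} (h : encode (addSystem n (greedyState n S s)) ∈ S) :
    (greedyState n S (s + 1)).2 = (greedyState n S s).2 := by
  rw [greedyState, greedyStep, charNat_of_mem h, if_neg one_ne_zero]

end Greedy

/-! ### Finite systems over a finitely generated group, and the group computed by the jump. -/

section WordProblem

variable {G : Type*} [Group G] {n : ℕ} (g : Fin n → G)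

theorem encode_mem_wordProblem {w : List (Fin n × Bool)} :
    encode w ∈ wordProblem g ↔ evalWord g w = 1 := by
  constructor
  · rintro ⟨v, h1, h2⟩
    rw [encode_injective.eq_iff] at h1
    exact h1 ▸ h2
  · exact fun h => ⟨w, rfl, h⟩

/-- The relators of a group, as words in the first letters. -/
def groupRelators : Set Word := relabelWord Fin.val '' {w | evalWord g w = 1}

/-- The words in the first letters which are not trivial in a group. -/
def groupNonrelators : Set Word := relabelWord Fin.val '' {w | evalWord g w ≠ 1}

theorem lettersBelow_relabelWord_val (w : List (Fin n × Bool)) :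
    LettersBelow n (relabelWord Fin.val w) := by
  intro p hp
  obtain ⟨q, -, rfl⟩ := List.mem_map.1 hp
  exact q.1.2

/-- The group itself is a model, with the unused letters sent to `1`. -/
theorem consistentRel_group : ConsistentRel (groupRelators g) (groupNonrelators g) := by
  let γ : ℕ → G := fun i => if h : i < n then g ⟨i, h⟩ else 1
  have hγ : ∀ w, evalWord γ (relabelWord Fin.val w) = evalWord g w := by
    intro w
    rw [evalWord_relabelWord]
    congr 1
    ext i
    simp [γ]
  rintro _ ⟨w, hw, rfl⟩ hm
  refine hw ?_
  rw [← hγ]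
  refine evalWord_eq_one_of_mem_relClosure ?_ hm
  rintro _ ⟨v, hv, rfl⟩
  rw [hγ]
  exact hv

/-- The relators of the group together with finitely many words. -/
def relatorsWith (A : List Word) : Set Word := groupRelators g ∪ {w | w ∈ A}

/-- The nontrivial words of the group together with finitely many words. -/
def nonrelatorsWith (B : List Word) : Set Word := groupNonrelators g ∪ {w | w ∈ B}

/-- The codes of finite systems which are inconsistent over the group. -/
def inconsistentSystems : Set ℕ :=
  encode '' {p : List Word × List Word |
    ¬ ConsistentRel (relatorsWith g p.1) (nonrelatorsWith g p.2)}

/-- Inconsistency is witnessed by one word that is both forbidden and a consequence. Enumerating the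
consequences takes positive facts of the word problem and enumerating the forbidden words negative
ones, hence the use of `literals`. -/
theorem enumRed_inconsistentSystems :
    EnumRed (inconsistentSystems g) (literals (wordProblem g)) := by
  have hrel : EnumRed (groupRelators g) (literals (wordProblem g)) := by
    have h := (EnumRed.self (literals (wordProblem g))).preimage
      (g := fun w : List (Fin n × Bool) => 2 * encode w + 1)
      (Primrec.nat_double_succ.comp Primrec.encode)
    convert h.image (primrec_relabelWord Primrec.fin_val) using 1
    rw [groupRelators]
    congr 1
    ext w
    exact (encode_mem_wordProblem g).symm.trans two_mul_add_one_mem_literals.symm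
  have hnonrel : EnumRed (groupNonrelators g) (literals (wordProblem g)) := by
    have h := (EnumRed.self (literals (wordProblem g))).preimage
      (g := fun w : List (Fin n × Bool) => 2 * encode w) (Primrec.nat_double.comp Primrec.encode)
    convert h.image (primrec_relabelWord Primrec.fin_val) using 1
    rw [groupNonrelators]
    congr 1
    ext w
    exact (encode_mem_wordProblem g).symm.not.trans two_mul_mem_literals.symm
  have hmem : EnumRed {p : List Word × Word | p.2 ∈ p.1} (literals (wordProblem g)) :=
    EnumRed.of_primrecPred (((Primrec.eq (α := Word)).exists_mem_list.comp .fst .snd).of_eq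
      fun p => by simp)
  -- The list of added relators is the parameter in which `EnumRed.relClosure` is uniform.
  have hY : EnumRed {p : List Word × Word | p.2 ∈ relatorsWith g p.1}
      (literals (wordProblem g)) := (hrel.preimage Primrec.snd).union hmem
  have hI : EnumRed {p : (List Word × List Word) × Word | p.2 ∈ nonrelatorsWith g p.1.2}
      (literals (wordProblem g)) := (hnonrel.preimage Primrec.snd).union
    (hmem.preimage (.pair (.comp .snd .fst) .snd))
  have hE := hY.relClosure.preimage
    (g := fun p : (List Word × List Word) × Word => (p.1.1, p.2)) (.pair (.comp .fst .fst) .snd)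
  convert ((hE.inter hI).image Primrec.fst).image Primrec.encode using 1
  rw [inconsistentSystems]
  congr 1
  ext p
  simp only [ConsistentRel, not_forall, not_not]
  constructor
  · rintro ⟨w, hw, h⟩
    exact ⟨(p, w), ⟨h, hw⟩, rfl⟩
  · rintro ⟨⟨q, w⟩, ⟨h, hw⟩, rfl⟩
    exact ⟨w, hw, h⟩

/-- The jump of the word problem of a finitely generated group computes a countable existentially
closed group which contains the group. -/
theorem exists_existentiallyClosed_computesGroup (hg : Subgroup.closure (Set.range g) = ⊤) :
    ∃ (M : Type) (_ : Group M), Countable M ∧ IsExistentiallyClosedGroup M ∧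
      (∃ i : G →* M, Function.Injective i) ∧ ComputesGroup (turingJump (wordProblem g)) M := by
  obtain ⟨S, hS⟩ : ∃ S, S = inconsistentSystems g := ⟨_, rfl⟩
  have hmemS : ∀ p : List Word × List Word, encode p ∉ S ↔
      ConsistentRel (relatorsWith g p.1) (nonrelatorsWith g p.2) := by
    intro p
    rw [hS, inconsistentSystems, encode_injective.mem_set_image]
    exact not_not
  let st := greedyState n S
  let E : ℕ → Set Word := fun s => relatorsWith g (st s).2.1
  let I : ℕ → Set Word := fun s => nonrelatorsWith g (st s).2.2
  have hstep : ∀ s, st (s + 1) = greedyStep n (st s) (charNat S (encode (addSystem n (st s)))) :=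
    fun s => rfl
  have hEI : ∀ s, E s ⊆ E (s + 1) ∧ I s ⊆ I (s + 1) := by
    intro s
    simp only [E, I, st]
    by_cases h : encode (addSystem n (greedyState n S s)) ∈ S
    · rw [greedyState_succ_of_mem n S h]
      exact ⟨subset_rfl, subset_rfl⟩
    · rw [greedyState_succ_of_notMem n S h]
      exact ⟨Set.union_subset_union_right _ fun w hw => List.mem_append_left _ hw,
        Set.union_subset_union_right _ fun w hw => List.mem_append_left _ hw⟩
  have hE : Monotone E := monotone_nat_of_le_succ fun s => (hEI s).1
  have hI : Monotone I := monotone_nat_of_le_succ fun s => (hEI s).2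
  have hc : ∀ s, ConsistentRel (E s) (I s) := by
    intro s
    induction s with
    | zero => simpa [E, I, st, greedyState, relatorsWith, nonrelatorsWith] using
        consistentRel_group g
    | succ s ih =>
      simp only [E, I, st] at ih ⊢
      by_cases h : encode (addSystem n (greedyState n S s)) ∈ S
      · rwa [greedyState_succ_of_mem n S h]
      · rw [greedyState_succ_of_notMem n S h]
        exact (hmemS _).1 h
  have hcons := consistentRel_iUnion hE hI hc
  obtain ⟨N, hN⟩ : ∃ N, N = relClosure (⋃ s, E s) := ⟨_, rfl⟩
  have hNn : N.Normal := hN ▸ inferInstance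
  refine ⟨FreeGroup ℕ ⧸ N, inferInstance, Quotient.countable, ?_, ?_, ?_⟩
  · subst hN
    refine isExistentiallyClosedGroup_of_stages hE hI hc fun A B => ?_
    obtain ⟨s, hs⟩ : ∃ s, s = encode (A, B) := ⟨_, rfl⟩
    have hsys : systemOfNat (st s).1 = (A, B) := by
      rw [greedyState_fst, hs, systemOfNat, encodek, Option.getD_some]
    have hb : freshLetter n (st s) =
        n + encode ((st s).2.1 ++ (st s).2.2) + encode (A ++ B) := by
      rw [freshLetter, hsys]
    have hlet : ∀ w ∈ (st s).2.1 ++ (st s).2.2, LettersBelow (freshLetter n (st s)) w :=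
      fun w hw => (lettersBelow_encode hw).mono (by lia)
    refine ⟨s, freshLetter n (st s), ?_, fun w hw p hp i hi =>
      (param_lt_encode hw p hp i hi).trans_le (by lia), fun h => ?_⟩
    · rintro w ((⟨v, -, rfl⟩ | hw) | (⟨v, -, rfl⟩ | hw))
      · exact (lettersBelow_relabelWord_val v).mono (by lia)
      · exact hlet w (List.mem_append_left _ hw)
      · exact (lettersBelow_relabelWord_val v).mono (by lia)
      · exact hlet w (List.mem_append_right _ hw)
    · have hadd : addSystem n (st s) = ((st s).2.1 ++ A.map (instWord (freshLetter n (st s))),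
          (st s).2.2 ++ B.map (instWord (freshLetter n (st s)))) := by
        rw [addSystem, hsys]
      have h1 : encode (addSystem n (st s)) ∉ S := by
        rw [hmemS, hadd]
        refine h.mono ?_ ?_
        · rintro w (hw | hw)
          · exact .inl (.inl hw)
          · rcases List.mem_append.1 hw with hw | hw
            · exact .inl (.inr hw)
            · exact .inr (List.mem_map.1 hw)
        · rintro w (hw | hw)
          · exact .inl (.inl hw)
          · rcases List.mem_append.1 hw with hw | hw
            · exact .inl (.inr hw)
            · exact .inr (List.mem_map.1 hw)
      have h2 : (st (s + 1)).2 = _ := (greedyState_succ_of_notMem n S h1).trans hadd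
      simp only [E, I, h2]
      exact ⟨fun w hw => .inr (List.mem_append_right _ (List.mem_map_of_mem hw)),
        fun w hw => .inr (List.mem_append_right _ (List.mem_map_of_mem hw))⟩
  · refine exists_injective_hom_of_evalWord_iff hg
      (fun i : Fin n => ((FreeGroup.of i.val : FreeGroup ℕ) : FreeGroup ℕ ⧸ N)) fun w => ?_
    have : evalWord (fun i : Fin n =>
        ((FreeGroup.of i.val : FreeGroup ℕ) : FreeGroup ℕ ⧸ N)) w = 1 ↔
        FreeGroup.mk (relabelWord Fin.val w) ∈ N := by
      rw [← QuotientGroup.eq_one_iff, ← evalWord_quotient, evalWord_relabelWord]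
      rfl
    rw [this, hN]
    constructor
    · exact fun hw => mk_mem_relClosure (Set.mem_iUnion.2 ⟨0, .inl ⟨w, hw, rfl⟩⟩)
    · intro hm
      by_contra hn
      exact hcons _ (Set.mem_iUnion.2 ⟨0, .inl ⟨w, hn, rfl⟩⟩) hm
  · refine computesGroup_quotient N ?_
    have hST : SetTuringReducible S (turingJump (wordProblem g)) :=
      hS ▸ setTuringReducible_turingJump (enumRed_inconsistentSystems g)
    -- The stage at which the `k`-th word is proposed as a single equation, without variables or
    -- inequations.
    let m : ℕ → ℕ := fun k =>
      encode (([relabelWord Sum.inl (wordOfNat k)], []) : WordSystem)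
    have hm : Primrec m := Primrec.encode.comp (.pair (Primrec.list_cons.comp
      ((primrec_relabelWord Primrec.sumInl).comp primrec_wordOfNat) (.const [])) (.const []))
    have hadd : ∀ k, addSystem n (st (m k)) =
        ((st (m k)).2.1 ++ [wordOfNat k], (st (m k)).2.2) := by
      intro k
      have hsys : systemOfNat (st (m k)).1 = ([relabelWord Sum.inl (wordOfNat k)], []) := by
        rw [greedyState_fst, systemOfNat, encodek, Option.getD_some]
      rw [addSystem, hsys]
      simp [instWord_relabelWord_inl]
    -- If the word is trivial in the limit, adding it yields only consequences that lie in `N`,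
    -- which contains no forbidden word; so it is accepted. If it is accepted, it becomes a relator.
    have key : ∀ k, FreeGroup.mk (wordOfNat k) ∈ N ↔ encode (addSystem n (st (m k))) ∉ S := by
      intro k
      constructor
      · intro hk
        rw [hmemS, hadd]
        intro w hw h
        refine hcons w (Set.mem_iUnion.2 ⟨m k, hw⟩) ?_
        refine Subgroup.normalClosure_le_normal ?_ h
        rintro _ ⟨v, hv | hv, rfl⟩
        · exact mk_mem_relClosure (Set.mem_iUnion.2 ⟨m k, .inl hv⟩)
        · rcases List.mem_append.1 hv with hv | hv
          · exact mk_mem_relClosure (Set.mem_iUnion.2 ⟨m k, .inr hv⟩)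
          · rw [List.mem_singleton.1 hv, SetLike.mem_coe, ← hN]
            exact hk
      · intro hk
        have h2 : (st (m k + 1)).2 = _ := (greedyState_succ_of_notMem n S hk).trans (hadd k)
        rw [hN]
        refine mk_mem_relClosure (Set.mem_iUnion.2 ⟨m k + 1, .inr ?_⟩)
        rw [h2]
        exact List.mem_append_right _ (List.mem_singleton_self _)
    have hq : RecIn S fun k => encode (addSystem n (st (m k))) :=
      RecIn.process (q := fun p => encode (addSystem n p))
        (Primrec.encode.comp (primrec_addSystem n)) (primrec_greedyStep n) hstep hm
        (out := fun _ p => encode (addSystem n p))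
        (Primrec.encode.comp ((primrec_addSystem n).comp .snd))
    refine RecIn.setTuringReducible (.of_setTuringReducible hST ?_)
    have h3 : charNat {k | FreeGroup.mk (wordOfNat k) ∈ N} =
        fun k => 1 - charNat S (encode (addSystem n (st (m k)))) := by
      ext k
      by_cases h : encode (addSystem n (st (m k))) ∈ S
      · rw [charNat_of_mem h, charNat_of_notMem fun h' => (key k).1 h' h]
      · rw [charNat_of_notMem h,
          charNat_of_mem (X := {k | FreeGroup.mk (wordOfNat k) ∈ N}) ((key k).2 h)]
    rw [h3]
    exact (RecIn.of_primrec (f := fun v => 1 - v) (Primrec.nat_sub.comp (.const 1) .id)).comp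
      (RecIn.oracle.comp hq)

end WordProblem

theorem mainTheorem8 {G : Type*} [Group G] {n : ℕ} (g : Fin n → G)
    (hg : Subgroup.closure (Set.range g) = ⊤) :
    (∃ (M : Type) (_ : Group M), Countable M ∧ IsExistentiallyClosedGroup M ∧
      (∃ i : G →* M, Function.Injective i) ∧
      ComputesGroup (turingJump (wordProblem g)) M) ∧
    (∃ (M : Type) (_ : Group M), Countable M ∧ IsExistentiallyClosedGroup M ∧
      ∀ (F : Type) [Group F] (k : ℕ) (f : Fin k → F),
        Subgroup.closure (Set.range f) = ⊤ →
          ((∃ i : F →* M, Function.Injective i) ↔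
            EnumReducible (wordProblem f) (wordProblem g))) :=
  ⟨exists_existentiallyClosed_computesGroup g hg,
    exists_existentiallyClosed_enumReducible (wordProblem g)⟩
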